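/- Let $(V,q)$ be a real quadratic space of signature $(4,n+2)$, $n\ge 2$, with $(x,y)=q(x+y)-q(x)-q(y)$, and let $b_{\pm1},\dots,b_{\pm4}\in V$ be isotropic vectors with $(b_i,b_j)=(b_{-i},b_{-j})=0$ and $(b_i,b_{-j})=\delta_{ij}$ for $i,j>0$. Put $U=\langle b_1,b_2\rangle$, $U^\vee=\langle b_{-1},b_{-2}\rangle$, $V_{2,n}=(U+U^\vee)^\perp$, $y_0=b_3+b_{-3}$, $y_1=b_4+b_{-4}$, $V_{1,n}=V_{2,n}\cap y_0^\perp$, $u_j=(b_j+b_{-j})/\sqrt2$ for $j=1,2$, $v_1=y_0/\sqrt2$, $v_2=y_1/\sqrt2$, $V^+=\langle u_1,u_2,v_1,v_2\rangle$, $V^-=(V^+)^\perp$. Let $v\wedge w$ act on $V$ by $x\mapsto (w,x)v-(v,x)w$; this identifies $\wedge^2V$ with $\mathrm{Lie}\,G$, where $G=\mathrm{SO}(V)$. Let $M_P\subset G$ be the stabilizer of $U$ and $U^\vee$, let $N_P=\{\exp(b_1\wedge w_1+b_2\wedge w_2+z\,b_1\wedge b_2): w_1,w_2\in V_{2,n},\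 z\in\mathbb R\}$, and let $K\subset G$ be the stabilizer of $V=V^+\oplus V^-$; a superscript $0$ denotes the identity component. Let $\ell\ge1$ and $\mathbf V_\ell=\mathrm{Sym}^{2\ell}(\mathbb C^2)$, with $x,y$ the standard basis of $\mathbb C^2$, on which $K^0$ acts through the homomorphism $K^0\to \mathrm{SU}(2)/\{\pm1\}$ given by the adjoint action of $K^0$ on the $\mathfrak{sl}_2$ spanned by $e^+=\frac12(u_1-iu_2)\wedge(v_1-iv_2)$, $h^+=i(u_1\wedge u_2+v_1\wedge v_2)$, $f^+=-\frac12(u_1+iu_2)\wedge(v_1+iv_2)$, identified with $\mathrm{Sym}^2(\mathbb C^2)$ by $e^+=-x^2$, $h^+=2xy$, $f^+=y^2$. Let $\mathfrak p=(V^+\wedge V^-)\otimes\mathbb C\cong\mathbb C^2\boxtimes W$, and for $F:G\to\mathbf V_\ell$ let $D_\ell F$ be the projection of $\sum_\alpha X_\alpha F\otimes X_\alpha^\vee$ (where $\{X_\alpha\}$ is a basis of $\mathfrak p$, acting by right translation) from $\mathbf V_\ell\otimes\mathfrak p^\vee$ to $\mathrm{Sym}^{2\ell-1}(\mathbb C^2)\otimes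 W$. For $T_1,T_2\in V_{2,n}$ and $r\in M_P$ put $$\beta_{[T_1,T_2]}(r)=\sqrt2\,i\,B\big(r^{-1}(b_{-1}\otimes T_1+b_{-2}\otimes T_2),\ b_1\otimes(v_1+iv_2)+b_2\otimes i(v_1+iv_2)\big),$$ where $B(\xi\otimes y,u\otimes w)=(\xi,u)(y,w)$, and write $[T_1,T_2]\succeq0$ if $\beta_{[T_1,T_2]}$ has no zero on $M_P^0$. In that case let $\mathcal W_{[T_1,T_2]}:G\to\mathbf V_\ell$ be the generalized Whittaker function, that is, a smooth function of moderate growth with (i) $\mathcal W(gk)=k^{-1}\mathcal W(g)$ for $k\in K^0$; (ii) $\mathcal W(ng)=e^{i(T_1,w_1)+i(T_2,w_2)}\mathcal W(g)$ for $n=\exp(b_1\wedge w_1+b_2\wedge w_2+z\,b_1\wedge b_2)\in N_P$; (iii) $D_\ell\mathcal W=0$; normalized by $$\mathcal W(r)=\det(m)^\ell|\det(m)|\sum_{v=-\ell}^{\ell}\Big(\frac{\beta(r)}{|\beta(r)|}\Big)^vK_v(|\beta(r)|)\frac{x^{\ell+v}y^{\ell-v}}{(\ell+v)!(\ell-v)!}\qquad(r\in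 M_P^0,\ m=r|_U,\ \beta=\beta_{[T_1,T_2]}),$$ with $K_\nu(z)=\frac12\int_0^\infty t^{\nu-1}e^{-z(t+t^{-1})/2}\,dt$. **Proposition.** Let $T\in V_{1,n}$ be positive definite, that is, $(T,-y_1)>0$ and $(T,T)>0$, and suppose $[y_0,T]\succeq0$. Let $t>0$ and $u\in\mathrm{SO}(V_{1,n})^0$, and let $h=(t,u)\in G$ be the element that is $t$ on $b_2$, $t^{-1}$ on $b_{-2}$, $u$ on $V_{1,n}$ and the identity on $b_1,b_{-1},y_0$. Then $s\mapsto\mathcal W_{[y_0,T]}(\exp(s\,b_1\wedge b_{-2})h)$ is integrable on $\mathbb R$ and $$\int_{\mathbb R}\mathcal W_{[y_0,T]}(\exp(s\,b_1\wedge b_{-2})\,h)\,ds=\frac{\pi\,t^\ell e^{-(2-t(T,u\cdot y_1))}}{2}\sum_{v=-\ell}^{\ell}i^v\frac{x^{\ell+v}y^{\ell-v}}{(\ell-v)!(\ell+v)!}.$$ Moreover, for all integers $-\ell\le v\le\ell$ and all real $X>0$ (with $0^0=1$), $$\sum_{k=0}^{\lfloor|v|/2\rfloor}\binom{|v|}{2k}\frac{(i\,\mathrm{sgn}(v)X)^{|v|-2k}\,2^{(2k-1)/2}\,\Gamma\!\left(\frac{2k+1}2\right)}{X^{|v|-(2k+1)/2}}K_{|v|-(2k+1)/2}(X)=\frac{\pi}{2}e^{-X}i^v.$$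 -/

import Mathlib

open MeasureTheory
open scoped ContDiff

noncomputable section

namespace QuaternionicWhittaker

/-- A real quadratic space `(V, q)` of signature `(4, n + 2)`, `n + 6 = dim V`, `n ≥ 2`, with two
dual bases `b 0, …, b 3` (written `b_1, …, b_4` on paper) and `b' 0, …, b' 3` (written
`b_{-1}, …, b_{-4}`) of isotropic four-dimensional subspaces that are in duality under
`(x, y) = q (x + y) - q x - q y`.  The condition `neg` says that the orthogonal complement of these
eight vectors is negative definite (possibly zero); as the eight vectors span four hyperbolic planes
this is the same as the signature being `(4, dim V - 4)`. -/
structure SplitSpace (V : Type*) [NormedAddCommGroup V] [NormedSpace ℝ V] where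
  q : QuadraticForm ℝ V
  b : Fin 4 → V
  b' : Fin 4 → V
  b_b : ∀ i j, QuadraticMap.polar q (b i) (b j) = 0
  b'_b' : ∀ i j, QuadraticMap.polar q (b' i) (b' j) = 0
  b_b' : ∀ i j, QuadraticMap.polar q (b i) (b' j) = if i = j then 1 else 0
  neg : ∀ x, (∀ i, QuadraticMap.polar q x (b i) = 0) → (∀ i, QuadraticMap.polar q x (b' i) = 0) →
    x ≠ 0 → q x < 0

namespace SplitSpace

/- The norm of `V` only provides the topology of the finite-dimensional space `V` and of the algebra
`V →L[ℝ] V` of its endomorphisms; no compatibility with `q` is asked for. -/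
variable {V : Type*} [NormedAddCommGroup V] [NormedSpace ℝ V] (D : SplitSpace V)

/-- The bilinear form `(x, y) = q (x + y) - q x - q y`. -/
def pair (x y : V) : ℝ := QuadraticMap.polar D.q x y

/-- `u_1 = (b_1 + b_{-1}) / √2`. -/
def u₁ : V := (√2)⁻¹ • (D.b 0 + D.b' 0)

/-- `u_2 = (b_2 + b_{-2}) / √2`. -/
def u₂ : V := (√2)⁻¹ • (D.b 1 + D.b' 1)

/-- `y_0 = b_3 + b_{-3}`. -/
def y₀ : V := D.b 2 + D.b' 2

/-- `y_1 = b_4 + b_{-4}`. -/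
def y₁ : V := D.b 3 + D.b' 3

/-- `v_1 = y_0 / √2`. -/
def v₁ : V := (√2)⁻¹ • D.y₀

/-- `v_2 = y_1 / √2`. -/
def v₂ : V := (√2)⁻¹ • D.y₁

/-- The isotropic plane `U = span {b_1, b_2}`. -/
def U : Submodule ℝ V := Submodule.span ℝ {D.b 0, D.b 1}

/-- The isotropic plane `U^∨ = span {b_{-1}, b_{-2}}`. -/
def Udual : Submodule ℝ V := Submodule.span ℝ {D.b' 0, D.b' 1}

/-- `x ∈ V_{2,n}`, the orthogonal complement of `U + U^∨`. -/
def MemV2n (x : V) : Prop :=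
  D.pair x (D.b 0) = 0 ∧ D.pair x (D.b 1) = 0 ∧ D.pair x (D.b' 0) = 0 ∧ D.pair x (D.b' 1) = 0

/-- `x ∈ V_{1,n}`, the orthogonal complement of `y_0` in `V_{2,n}`. -/
def MemV1n (x : V) : Prop := D.MemV2n x ∧ D.pair x D.y₀ = 0

/-- The positive definite four-space `V^+`. -/
def Vplus : Submodule ℝ V := Submodule.span ℝ {D.u₁, D.u₂, D.v₁, D.v₂}

/-- `x ∈ V^-`, the orthogonal complement of `V^+`. -/
def MemVminus (x : V) : Prop := ∀ w ∈ D.Vplus, D.pair x w = 0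

/-- A vector `T` of `V_{1,n}` is positive definite. -/
def PosDef (T : V) : Prop := 0 < D.pair T (-D.y₁) ∧ 0 < D.pair T T

/-- `G(ℝ) = SO(V)`. -/
def SO : Set (V →L[ℝ] V) :=
  {g | (∀ x, D.q (g x) = D.q x) ∧ LinearMap.det (g : V →ₗ[ℝ] V) = 1}

/-- The Lie algebra of `G(ℝ)`. -/
def so : Submodule ℝ (V →L[ℝ] V) where
  carrier := {X | ∀ x y, D.q.polarBilin (X x) y + D.q.polarBilin x (X y) = 0}
  zero_mem' := by intro x y; simp
  add_mem' := by
    intro X Y hX hY x y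
    have h1 := hX x y
    have h2 := hY x y
    simp only [add_apply, map_add, LinearMap.add_apply]
    linarith
  smul_mem' := by
    intro c X hX x y
    have h1 := hX x y
    simp only [smul_apply, map_smul, LinearMap.smul_apply, smul_eq_mul]
    rw [← mul_add, h1, mul_zero]

/-- `M_P(ℝ)`, the Levi subgroup of the Heisenberg parabolic: the stabilizer of `U` and `U^∨`. -/
def MP : Set (V →L[ℝ] V) :=
  {g | g ∈ D.SO ∧ (∀ x ∈ D.U, g x ∈ D.U) ∧ ∀ x ∈ D.Udual, g x ∈ D.Udual}

/-- The identity component `M_P(ℝ)^0`. -/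
def MP0 : Set (V →L[ℝ] V) := connectedComponentIn D.MP 1

/-- The maximal compact subgroup `K`: the stabilizer of the decomposition `V = V^+ ⊕ V^-`. -/
def K : Set (V →L[ℝ] V) :=
  {g | g ∈ D.SO ∧ (∀ x ∈ D.Vplus, g x ∈ D.Vplus) ∧ ∀ x, D.MemVminus x → D.MemVminus (g x)}

/-- The identity component `K^0 = SO(V^+) × SO(V^-)`. -/
def K0 : Set (V →L[ℝ] V) := connectedComponentIn D.K 1

/-- `SO(V_{1,n})(ℝ)`, as the subgroup of `SO(V)` fixing the orthogonal complement of `V_{1,n}`. -/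
def SO1n : Set (V →L[ℝ] V) :=
  {g | g ∈ D.SO ∧ g (D.b 0) = D.b 0 ∧ g (D.b 1) = D.b 1 ∧ g (D.b' 0) = D.b' 0 ∧
    g (D.b' 1) = D.b' 1 ∧ g D.y₀ = D.y₀}

/-- The identity component `SO(V_{1,n})(ℝ)^0`. -/
def SO1n0 : Set (V →L[ℝ] V) := connectedComponentIn D.SO1n 1

/-- `β_{[T₁,T₂]} (r)` is `√2 i` times the pairing of `r⁻¹ (b_{-1} ⊗ T₁ + b_{-2} ⊗ T₂)` with
`b_1 ⊗ (v_1 + i v_2) + b_2 ⊗ i (v_1 + i v_2)`, where `ξ ⊗ y` and `u ⊗ w` pair to `(ξ, u) (y, w)`,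
complex bilinearly. -/
def beta (T₁ T₂ : V) (r : V →L[ℝ] V) : ℂ :=
  let ri : V →L[ℝ] V := Ring.inverse r
  let c : V → ℂ := fun y => (D.pair y D.v₁ : ℂ) + Complex.I * (D.pair y D.v₂ : ℂ)
  let B : V → V → ℂ := fun ξ y =>
    (D.pair ξ (D.b 0) : ℂ) * c y + (D.pair ξ (D.b 1) : ℂ) * (Complex.I * c y)
  (√2 : ℂ) * Complex.I * (B (ri (D.b' 0)) (ri T₁) + B (ri (D.b' 1)) (ri T₂))

/-- The pair `[T₁, T₂]` is positive semi-definite. -/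
def PosSemidefPair (T₁ T₂ : V) : Prop := ∀ r ∈ D.MP0, D.beta T₁ T₂ r ≠ 0

/-- For `r = (m, h) ∈ M_P(ℝ)`, the determinant of `m = r|_U` in the basis `b_1, b_2`. -/
def detU (r : V →L[ℝ] V) : ℝ :=
  D.pair (D.b' 0) (r (D.b 0)) * D.pair (D.b' 1) (r (D.b 1)) -
    D.pair (D.b' 0) (r (D.b 1)) * D.pair (D.b' 1) (r (D.b 0))

variable [FiniteDimensional ℝ V]

/-- The element `v ∧ w` of the Lie algebra of `SO(V)`, acting by `x ↦ (w, x) v - (v, x) w`. -/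
def wedge (v w : V) : V →L[ℝ] V :=
  LinearMap.toContinuousLinearMap
    ((D.q.polarBilin w).smulRight v - (D.q.polarBilin v).smulRight w)

/-- The element `(t, 1)` of `M_R = 𝔾_m × SO(V_{1,n})`: it is `t` on `b_2`, `t⁻¹` on `b_{-2}`, and
the identity on the orthogonal complement of these two vectors. -/
def torus (t : ℝ) : V →L[ℝ] V :=
  1 + LinearMap.toContinuousLinearMap
    ((t - 1) • (D.q.polarBilin (D.b' 1)).smulRight (D.b 1) +
      (t⁻¹ - 1) • (D.q.polarBilin (D.b 1)).smulRight (D.b' 1))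

/-- The real form of the first `𝔰𝔩₂` with basis
`-i h⁺ = u_1 ∧ u_2 + v_1 ∧ v_2`, `e⁺ - f⁺ = u_1 ∧ v_1 - u_2 ∧ v_2`,
`i (e⁺ + f⁺) = u_1 ∧ v_2 + u_2 ∧ v_1`, where
`e⁺ = ½ (u_1 - i u_2) ∧ (v_1 - i v_2)`, `h⁺ = i (u_1 ∧ u_2 + v_1 ∧ v_2)`,
`f⁺ = -½ (u_1 + i u_2) ∧ (v_1 + i v_2)`. -/
def su2V (a b c : ℝ) : V →L[ℝ] V :=
  a • (D.wedge D.u₁ D.u₂ + D.wedge D.v₁ D.v₂) + b • (D.wedge D.u₁ D.v₁ - D.wedge D.u₂ D.v₂) +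
    c • (D.wedge D.u₁ D.v₂ + D.wedge D.u₂ D.v₁)

end SplitSpace

/-- The matrix `a (-i h) + b (e - f) + c i (e + f)` of `𝔰𝔲(2)`, for the standard triple
`h = diag (1, -1)`, `e`, `f` of two by two matrices.  Under `Sym² (ℂ²) ≅ 𝔰𝔩₂`,
`e = -x²`, `h = 2 x y`, `f = y²`, for `x, y` the standard basis of `ℂ²`. -/
def su2M (a b c : ℝ) : Matrix (Fin 2) (Fin 2) ℂ :=
  !![-(a * Complex.I), b + c * Complex.I; -b + c * Complex.I, a * Complex.I]

/-- `𝐕_ℓ = Sym^{2ℓ} (ℂ²)`: the vector `c` stands for `∑ j, c j • x ^ j * y ^ (2 ℓ - j)`. -/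
abbrev VV (ℓ : ℕ) : Type := Fin (2 * ℓ + 1) → ℂ

/-- The vector `x^{ℓ+v} y^{ℓ-v}` of `𝐕_ℓ`, for `-ℓ ≤ v ≤ ℓ`. -/
def xy (ℓ : ℕ) (v : ℤ) : VV ℓ := fun j => if (j : ℤ) = ℓ + v then 1 else 0

/-- The homogeneous polynomial in `x = X 0`, `y = X 1` that a vector of `𝐕_ℓ` stands for. -/
def toPoly {ℓ : ℕ} (c : VV ℓ) : MvPolynomial (Fin 2) ℂ :=
  ∑ j : Fin (2 * ℓ + 1), MvPolynomial.C (c j) *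
    (MvPolynomial.X 0 ^ (j : ℕ) * MvPolynomial.X 1 ^ (2 * ℓ - (j : ℕ)))

/-- The action on polynomials of a matrix `A` acting on `ℂ²` with standard basis `x, y`. -/
def act (A : Matrix (Fin 2) (Fin 2) ℂ) (p : MvPolynomial (Fin 2) ℂ) : MvPolynomial (Fin 2) ℂ :=
  MvPolynomial.aeval (fun j => ∑ i, MvPolynomial.C (A i j) * MvPolynomial.X i) p

/-- The modified Bessel function `K_ν (x)`, `x > 0`. -/
def besselK (ν x : ℝ) : ℝ :=
  1 / 2 * ∫ t in Set.Ioi (0 : ℝ), t ^ (ν - 1) * Real.exp (-(x * (t + t⁻¹) / 2))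

/-- The finite sum `S_v (X)` of modified Bessel functions of half-integral order. -/
def besselSum (v : ℤ) (X : ℝ) : ℂ :=
  ∑ k ∈ Finset.range (v.natAbs / 2 + 1),
    (v.natAbs.choose (2 * k) : ℂ) * (Complex.I * (v.sign : ℂ) * (X : ℂ)) ^ (v.natAbs - 2 * k) *
      (((2 : ℝ) ^ ((2 * (k : ℝ) - 1) / 2) * Real.Gamma ((2 * (k : ℝ) + 1) / 2) /
        X ^ ((v.natAbs : ℝ) - (2 * (k : ℝ) + 1) / 2) *
        besselK ((v.natAbs : ℝ) - (2 * (k : ℝ) + 1) / 2) X : ℝ) : ℂ)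

namespace SplitSpace

variable {V : Type*} [NormedAddCommGroup V] [NormedSpace ℝ V] (D : SplitSpace V)

/-- The action of the Lie algebra by right translation: `(X W)(g) = d/dt W (g exp (t X))` at `t = 0`. -/
def rightDeriv {ℓ : ℕ} (W : (V →L[ℝ] V) → VV ℓ) (X g : V →L[ℝ] V) : VV ℓ :=
  deriv (fun t : ℝ => W (g * NormedSpace.exp (t • X))) 0

/-- The explicit function on `M_P(ℝ)^0` that normalizes the generalized Whittaker function. -/
def whittakerLevi (ℓ : ℕ) (T₁ T₂ : V) (r : V →L[ℝ] V) : VV ℓ :=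
  (((D.detU r) ^ ℓ * |D.detU r| : ℝ) : ℂ) • ∑ v ∈ Finset.Icc (-(ℓ : ℤ)) (ℓ : ℤ),
    ((D.beta T₁ T₂ r / (‖D.beta T₁ T₂ r‖ : ℂ)) ^ v * (besselK (v : ℝ) ‖D.beta T₁ T₂ r‖ : ℂ) /
      (((ℓ + v).toNat.factorial : ℂ) * ((ℓ - v).toNat.factorial : ℂ))) • xy ℓ v

variable [FiniteDimensional ℝ V]

/-- The matrix `A ∈ SU(2)` represents the image of `k` under the distinguished homomorphism
`K^0 → SU(2)/{±1}`: the adjoint action of `k` on the first `𝔰𝔩₂` is conjugation by `A`. -/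
def Lifts (k : V →L[ℝ] V) (A : Matrix.specialUnitaryGroup (Fin 2) ℂ) : Prop :=
  ∀ a b c a' b' c' : ℝ,
    (A : Matrix (Fin 2) (Fin 2) ℂ) * su2M a b c = su2M a' b' c' * (A : Matrix (Fin 2) (Fin 2) ℂ) →
      k * D.su2V a b c = D.su2V a' b' c' * k

/-- `D_ℓ W (g) = 0`.

As a module for the first `𝔰𝔩₂`, `V^+ ⊗ ℂ` is a sum of two copies of `ℂ²`; bases corresponding to
`(x, y)` are `(u_1 - i u_2, v_1 + i v_2)` and `(v_1 - i v_2, -(u_1 + i u_2))`.  So `𝔭 = V^+ ∧ V^-`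
is spanned over `ℂ` by vectors `X_x, X_y` of the form `x ⊗ w, y ⊗ w`, with `w` in either copy of
`V^- ⊗ ℂ`, and the component of `∑ X_α W ⊗ X_α^∨` in `Sym^{2ℓ-1} ⊗ (either copy of V^-)^∨` is given
by the contraction `Sym^{2ℓ} (ℂ²) ⊗ (ℂ²)^∨ → Sym^{2ℓ-1} (ℂ²)`, that is, by
`∂_x (X_x W) + ∂_y (X_y W)`.  Complex combinations of Lie algebra elements act complex linearly. -/
def DiracVanishes {ℓ : ℕ} (W : (V →L[ℝ] V) → VV ℓ) (g : V →L[ℝ] V) : Prop :=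
  ∀ w, D.MemVminus w →
    MvPolynomial.pderiv 0 (toPoly (rightDeriv W (D.wedge D.u₁ w) g -
          Complex.I • rightDeriv W (D.wedge D.u₂ w) g)) +
        MvPolynomial.pderiv 1 (toPoly (rightDeriv W (D.wedge D.v₁ w) g +
          Complex.I • rightDeriv W (D.wedge D.v₂ w) g)) = 0 ∧
      MvPolynomial.pderiv 0 (toPoly (rightDeriv W (D.wedge D.v₁ w) g -
          Complex.I • rightDeriv W (D.wedge D.v₂ w) g)) -
        MvPolynomial.pderiv 1 (toPoly (rightDeriv W (D.wedge D.u₁ w) g +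
          Complex.I • rightDeriv W (D.wedge D.u₂ w) g)) = 0

/-- `W : G(ℝ) → 𝐕_ℓ` is the generalized Whittaker function `𝒲_{[T₁,T₂]}`, for `[T₁,T₂] ⪰ 0`: a
smooth function of moderate growth with the equivariance properties under `K^0` and `N_P(ℝ)`, in
the kernel of `D_ℓ`, normalized on `M_P(ℝ)^0`.  Functions on `G(ℝ)` are written as functions of all
endomorphisms of `V`; only their values on `G(ℝ) = D.SO` enter. -/
structure IsWhittaker (ℓ : ℕ) (T₁ T₂ : V) (W : (V →L[ℝ] V) → VV ℓ) : Prop where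
  smooth : ∀ g ∈ D.SO, ContDiff ℝ ∞ (fun X : D.so => W (g * NormedSpace.exp (X : V →L[ℝ] V)))
  moderate_growth : ∃ (C : ℝ) (N : ℕ), ∀ g ∈ D.SO, ‖W g‖ ≤ C * ‖g‖ ^ N
  K_equivariant : ∀ g ∈ D.SO, ∀ k ∈ D.K0, ∀ A : Matrix.specialUnitaryGroup (Fin 2) ℂ,
    D.Lifts k A → toPoly (W (g * k)) = act (A⁻¹ : Matrix.specialUnitaryGroup (Fin 2) ℂ) (toPoly (W g))
  N_equivariant : ∀ g ∈ D.SO, ∀ w₁ w₂ : V, D.MemV2n w₁ → D.MemV2n w₂ → ∀ z : ℝ,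
    W (NormedSpace.exp (D.wedge (D.b 0) w₁ + D.wedge (D.b 1) w₂ + z • D.wedge (D.b 0) (D.b 1)) * g)
      = Complex.exp (Complex.I * (D.pair T₁ w₁ + D.pair T₂ w₂)) • W g
  dirac : ∀ g ∈ D.SO, D.DiracVanishes W g
  normalized : ∀ r ∈ D.MP0, W r = D.whittakerLevi ℓ T₁ T₂ r

end SplitSpace

end QuaternionicWhittaker

end

/-! The elements exp(s b₁∧b₋₂)h lie in M_P⁰ (`leviElt_mem_MP0`), where 𝒲 is explicit, and there β =
-2ts + ia with a = 2 - t(T, u·y₁) (`beta_leviElt`). Since V_{1,n} is Lorentzian and SO(V_{1,n})⁰ is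
connected, (T, u·y₁) keeps the negative sign it has at u = 1 (`pair_map_y₁_neg`), so a > 0. After
rescaling s, the first claim says that the integral of (z/|z|)^v K_v(|z|) over the horizontal line
Im z = a is π e^{-a} i^v (`besselPhase_integral`).

For v = n ≥ 0 the integrand is z^n times a function of |z|² = x² + a² that is a superposition of
Gaussians in x. Expanding (-x + ia)^n and integrating over x first (`integral_pow_mul_besselInt`)
leaves 2 i^n S_n(a), where S_n = `besselSumReal n` is the real factor of the Bessel sum in the
second claim. Negative v follow by complex conjugation.

Both claims thus rest on S_n(x) = (π/2)e^{-x} for every n (`besselSumReal_eq`). Pascal's rule gives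
S_{n+1} = -S_n' (`hasDerivAt_besselSumReal`), so only S_0 is needed, that is, the closed form of
K_{1/2} (`besselInt_neg_half`). -/

namespace QuaternionicWhittaker

/-! ### Bessel integrals and the closed form at order 1/2. -/

/-- `∫₀^∞ t^{ν-1} e^{-(c t + t⁻¹)/2} dt`, which is `2 c^{-ν/2} K_ν (√c)`. -/
noncomputable def besselInt (ν c : ℝ) : ℝ :=
  ∫ t in Set.Ioi (0 : ℝ), t ^ (ν - 1) * Real.exp (-((c * t + t⁻¹) / 2))

/-- Decay of every polynomial order at t = 0, used to tame t^{ν-1} there when ν ≤ 0. -/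
theorem exp_neg_inv_le (N : ℕ) {t : ℝ} (ht : 0 < t) :
    Real.exp (-(t⁻¹ / 2)) ≤ N.factorial * 2 ^ N * t ^ N := by
  have h := Real.pow_div_factorial_le_exp (t⁻¹ / 2) (by positivity) N
  rw [Real.exp_neg]
  have h0 : 0 < (t⁻¹ / 2) ^ N / (N.factorial : ℝ) := by positivity
  calc (Real.exp (t⁻¹ / 2))⁻¹ ≤ ((t⁻¹ / 2) ^ N / (N.factorial : ℝ))⁻¹ := inv_anti₀ h0 h
    _ = N.factorial * 2 ^ N * t ^ N := by
      rw [inv_div, div_pow, inv_pow]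
      field_simp

theorem measurable_besselInt_integrand (ν c : ℝ) :
    Measurable fun t : ℝ => t ^ (ν - 1) * Real.exp (-((c * t + t⁻¹) / 2)) := by
  fun_prop

theorem integrableOn_besselInt (ν : ℝ) {c : ℝ} (hc : 0 < c) :
    IntegrableOn (fun t : ℝ => t ^ (ν - 1) * Real.exp (-((c * t + t⁻¹) / 2))) (Set.Ioi 0) := by
  -- With ν + N > 0 the majorant t^{ν-1+N} e^{-ct/2} is integrable at 0 as well as at infinity.
  obtain ⟨N, hN⟩ := exists_nat_gt (-ν)
  have h1 : IntegrableOn (fun t : ℝ => t ^ (ν - 1 + N) * Real.exp (-(c / 2) * t ^ (1 : ℝ)))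
      (Set.Ioi 0) :=
    integrableOn_rpow_mul_exp_neg_mul_rpow (by linarith) one_pos (by positivity)
  refine (h1.const_mul ((N.factorial : ℝ) * 2 ^ N)).mono'
    (measurable_besselInt_integrand ν c).aestronglyMeasurable ?_
  refine (ae_restrict_iff' measurableSet_Ioi).2 (.of_forall fun t ht => ?_)
  have ht : 0 < t := ht
  have h2 := exp_neg_inv_le N ht
  have h3 : Real.exp (-((c * t + t⁻¹) / 2)) = Real.exp (-(c / 2) * t) * Real.exp (-(t⁻¹ / 2)) := by
    rw [← Real.exp_add]; congr 1; ring
  rw [Real.norm_of_nonneg (by positivity), h3, Real.rpow_one, Real.rpow_add ht, Real.rpow_natCast]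
  calc t ^ (ν - 1) * (Real.exp (-(c / 2) * t) * Real.exp (-(t⁻¹ / 2)))
      ≤ t ^ (ν - 1) * (Real.exp (-(c / 2) * t) * (N.factorial * 2 ^ N * t ^ N)) := by gcongr
    _ = _ := by ring

/-- Differentiating e^{-ct/2} in c brings down -t/2, which raises ν by one. The integrand at c/2
dominates all parameters above c/2. -/
theorem hasDerivAt_besselInt (ν : ℝ) {c : ℝ} (hc : 0 < c) :
    HasDerivAt (besselInt ν) (-(1 / 2) * besselInt (ν + 1) c) c := by
  have h := hasDerivAt_integral_of_dominated_loc_of_deriv_le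
    (μ := volume.restrict (Set.Ioi (0 : ℝ))) (x₀ := c) (s := Set.Ioi (c / 2))
    (bound := fun t => t ^ ((ν + 1) - 1) * Real.exp (-((c / 2 * t + t⁻¹) / 2)))
    (F := fun c t => t ^ (ν - 1) * Real.exp (-((c * t + t⁻¹) / 2)))
    (F' := fun c t => -(1 / 2) * (t ^ ((ν + 1) - 1) * Real.exp (-((c * t + t⁻¹) / 2))))
    (Ioi_mem_nhds (by linarith))
    (.of_forall fun c => (measurable_besselInt_integrand ν c).aestronglyMeasurable)
    (integrableOn_besselInt ν hc)
    ((measurable_besselInt_integrand (ν + 1) c).const_mul _).aestronglyMeasurable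
    ((ae_restrict_iff' measurableSet_Ioi).2 (.of_forall fun t ht x hx => by
      have ht : 0 < t := ht
      have hx : c / 2 < x := hx
      rw [norm_mul, Real.norm_of_nonneg (r := _ * _) (by positivity)]
      have : t ^ (ν + 1 - 1) * Real.exp (-((x * t + t⁻¹) / 2)) ≤
          t ^ (ν + 1 - 1) * Real.exp (-((c / 2 * t + t⁻¹) / 2)) := by gcongr
      have h0 : 0 ≤ t ^ (ν + 1 - 1) * Real.exp (-((x * t + t⁻¹) / 2)) := by positivity
      rw [Real.norm_of_nonpos (by norm_num)]
      linarith))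
    (integrableOn_besselInt (ν + 1) (by positivity))
    ((ae_restrict_iff' measurableSet_Ioi).2 (.of_forall fun t ht x hx => by
      have ht : 0 < t := ht
      have h1 : HasDerivAt (fun x : ℝ => -((x * t + t⁻¹) / 2)) (-((1 * t) / 2)) x :=
        ((((hasDerivAt_id x).mul_const t).add_const _).div_const 2).neg
      refine ((h1.exp.const_mul (t ^ (ν - 1)))).congr_deriv ?_
      have : t ^ (ν + 1 - 1) = t ^ (ν - 1) * t := by
        rw [← Real.rpow_add_one ht.ne']; congr 1; ring
      rw [this]; ring))
  have h2 := h.2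
  rw [integral_const_mul] at h2
  exact h2

/-- `K_ν (x) = x^ν / 2 · ∫ t^{ν-1} e^{-(x² t + t⁻¹)/2} dt`. -/
theorem besselK_eq (ν : ℝ) {x : ℝ} (hx : 0 < x) :
    besselK ν x = x ^ ν * (1 / 2 * besselInt ν (x ^ 2)) := by
  have h := integral_comp_mul_left_Ioi
    (fun t : ℝ => t ^ (ν - 1) * Real.exp (-(x * (t + t⁻¹) / 2))) 0 hx
  rw [mul_zero] at h
  have h2 : ∫ t in Set.Ioi (0 : ℝ), (x * t) ^ (ν - 1) * Real.exp (-(x * (x * t + (x * t)⁻¹) / 2)) =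
      x ^ (ν - 1) * besselInt ν (x ^ 2) := by
    rw [besselInt, ← integral_const_mul]
    refine setIntegral_congr_fun measurableSet_Ioi fun t ht => ?_
    have ht : 0 < t := ht
    change (x * t) ^ (ν - 1) * Real.exp (-(x * (x * t + (x * t)⁻¹) / 2)) = _
    rw [Real.mul_rpow hx.le ht.le, mul_assoc]
    congr 4
    field_simp
  rw [h2, smul_eq_mul] at h
  have h3 : x ^ ν = x ^ (ν - 1) * x := by
    rw [← Real.rpow_add_one hx.ne']; congr 1; ring
  rw [besselK, h3]
  have h4 : ∫ t in Set.Ioi (0 : ℝ), t ^ (ν - 1) * Real.exp (-(x * (t + t⁻¹) / 2)) =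
      x * (x ^ (ν - 1) * besselInt ν (x ^ 2)) := by
    rw [h, mul_inv_cancel_left₀ hx.ne']
  rw [h4]; ring

/-- The substitution t ↦ t⁻¹ preserves dt/t and t + t⁻¹ and inverts t^ν. -/
theorem besselK_neg (ν : ℝ) (x : ℝ) : besselK (-ν) x = besselK ν x := by
  unfold besselK
  congr 1
  rw [← integral_comp_rpow_Ioi _ (p := -1) (by norm_num)]
  refine setIntegral_congr_fun measurableSet_Ioi fun t ht => ?_
  have ht : 0 < t := ht
  simp only [abs_neg, abs_one, one_mul, smul_eq_mul]
  rw [Real.rpow_neg_one, inv_inv, ← mul_assoc, Real.inv_rpow ht.le, ← Real.rpow_neg ht.le,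
    ← Real.rpow_add ht, add_comm t⁻¹ t]
  congr 2; ring

/-- At c = 0 the integral still converges because the order is negative; t ↦ t⁻¹ turns it into a
Gamma integral with value √2 Γ(1/2). The same integrand dominates the limit c → 0. -/
theorem besselInt_neg_half_zero :
    IntegrableOn (fun t : ℝ => t ^ ((-1 / 2 : ℝ) - 1) * Real.exp (-((0 * t + t⁻¹) / 2))) (Set.Ioi 0) ∧
      besselInt (-1 / 2) 0 = √(2 * Real.pi) := by
  have key : ∀ t ∈ Set.Ioi (0 : ℝ), (|(-1 : ℝ)| * t ^ ((-1 : ℝ) - 1)) •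
      ((t ^ (-1 : ℝ)) ^ (-1 / 2 : ℝ) * Real.exp (-(1 / 2) * (t ^ (-1 : ℝ)) ^ (1 : ℝ))) =
      t ^ ((-1 / 2 : ℝ) - 1) * Real.exp (-((0 * t + t⁻¹) / 2)) := by
    intro t ht
    have ht : 0 < t := ht
    rw [← Real.rpow_mul ht.le, Real.rpow_one, Real.rpow_neg_one, smul_eq_mul, ← mul_assoc, abs_neg,
      abs_one, one_mul, ← Real.rpow_add ht]
    congr 2
    · norm_num
    · ring
  constructor
  · refine IntegrableOn.congr_fun ((integrableOn_Ioi_comp_rpow_iff (fun t : ℝ =>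
      t ^ (-1 / 2 : ℝ) * Real.exp (-(1 / 2) * t ^ (1 : ℝ))) (p := -1) (by norm_num)).2 ?_) key
      measurableSet_Ioi
    exact integrableOn_rpow_mul_exp_neg_mul_rpow (by norm_num) one_pos (by norm_num)
  · rw [besselInt, ← setIntegral_congr_fun measurableSet_Ioi key, integral_comp_rpow_Ioi (fun t : ℝ =>
      t ^ (-1 / 2 : ℝ) * Real.exp (-(1 / 2) * t ^ (1 : ℝ))) (by norm_num),
      integral_rpow_mul_exp_neg_mul_rpow one_pos (by norm_num) (by norm_num)]
    have h1 : (-1 / 2 + 1 : ℝ) / 1 = 1 / 2 := by norm_num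
    have h2 : -(-1 / 2 + 1 : ℝ) / 1 = -(1 / 2) := by norm_num
    rw [h1, h2, Real.Gamma_one_half_eq, Real.sqrt_mul (by norm_num), Real.rpow_neg (by norm_num),
      ← Real.inv_rpow (by norm_num), Real.sqrt_eq_rpow 2]
    norm_num

/-- This is K_{1/2} = K_{-1/2} in terms of `besselInt`. -/
theorem besselInt_half {x : ℝ} (hx : 0 < x) :
    x * besselInt (1 / 2) (x ^ 2) = besselInt (-1 / 2) (x ^ 2) := by
  have h := besselK_neg (1 / 2) x
  rw [besselK_eq _ hx, besselK_eq _ hx, Real.rpow_neg hx.le] at h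
  have h1 : x ^ (1 / 2 : ℝ) * x ^ (1 / 2 : ℝ) = x := by
    rw [← Real.rpow_add hx]; norm_num
  have h0 : 0 < x ^ (1 / 2 : ℝ) := by positivity
  rw [neg_div]
  field_simp at h
  linear_combination -h - besselInt (1 / 2) (x ^ 2) * h1

theorem hasDerivAt_besselInt_sq (ν : ℝ) {x : ℝ} (hx : 0 < x) :
    HasDerivAt (fun x => besselInt ν (x ^ 2)) (-(x * besselInt (ν + 1) (x ^ 2))) x := by
  have h := (hasDerivAt_besselInt ν (c := x ^ 2) (by positivity)).comp x (hasDerivAt_pow 2 x)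
  refine h.congr_deriv ?_
  norm_num; ring

theorem tendsto_besselInt_neg_half :
    Filter.Tendsto (fun x : ℝ => besselInt (-1 / 2) (x ^ 2)) (nhdsWithin 0 (Set.Ioi 0))
      (nhds √(2 * Real.pi)) := by
  rw [← besselInt_neg_half_zero.2]
  refine tendsto_integral_filter_of_dominated_convergence _
    (.of_forall fun x => (measurable_besselInt_integrand _ _).aestronglyMeasurable)
    (.of_forall fun x => ?_) besselInt_neg_half_zero.1 ?_
  · refine (ae_restrict_iff' measurableSet_Ioi).2 (.of_forall fun t ht => ?_)
    have ht : 0 < t := ht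
    rw [Real.norm_of_nonneg (by positivity)]
    gcongr
    positivity
  · refine .of_forall fun t => ?_
    have : Continuous fun x : ℝ => t ^ ((-1 / 2 : ℝ) - 1) * Real.exp (-((x ^ 2 * t + t⁻¹) / 2)) := by
      fun_prop
    have h := (this.tendsto 0).mono_left (nhdsWithin_le_nhds (s := Set.Ioi 0))
    simpa using h

/-- By `besselInt_half`, J(x) = `besselInt (-1/2) (x^2)` satisfies J' = -J. Hence J(x)e^x is
constant on x > 0, and its limit at 0⁺ gives the constant. -/
theorem besselInt_neg_half {x : ℝ} (hx : 0 < x) :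
    besselInt (-1 / 2) (x ^ 2) = √(2 * Real.pi) * Real.exp (-x) := by
  let f : ℝ → ℝ := fun x => besselInt (-1 / 2) (x ^ 2) * Real.exp x
  have hf : ∀ y ∈ Set.Ioi (0 : ℝ), HasDerivAt f 0 y := fun y hy => by
    have hy : 0 < y := hy
    refine ((hasDerivAt_besselInt_sq (-1 / 2) hy).mul (Real.hasDerivAt_exp y)).congr_deriv ?_
    have h1 := besselInt_half hy
    have h2 : (-1 / 2 + 1 : ℝ) = 1 / 2 := by norm_num
    rw [h2, h1]; ring
  have hconst : ∀ y ∈ Set.Ioi (0 : ℝ), f y = f x := fun y hy =>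
    isOpen_Ioi.is_const_of_deriv_eq_zero isPreconnected_Ioi
      (fun z hz => (hf z hz).differentiableAt.differentiableWithinAt)
      (fun z hz => (hf z hz).deriv) hy hx
  have hlim : Filter.Tendsto f (nhdsWithin 0 (Set.Ioi 0)) (nhds (√(2 * Real.pi) * Real.exp 0)) :=
    tendsto_besselInt_neg_half.mul (Real.continuous_exp.continuousAt.mono_left nhdsWithin_le_nhds)
  have hlim' : Filter.Tendsto f (nhdsWithin 0 (Set.Ioi 0)) (nhds (f x)) :=
    tendsto_const_nhds.congr' (Filter.eventually_of_mem self_mem_nhdsWithin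
      fun y hy => (hconst y hy).symm)
  have h := tendsto_nhds_unique hlim hlim'
  rw [Real.exp_zero, mul_one] at h
  rw [h, mul_assoc, ← Real.exp_add]
  simp

/-! ### The sum of Bessel functions of half-integral order. -/

/-- The Gaussian moment `2^{k-1/2} Γ(k+1/2)`, half of the integral of `x^{2k} e^{-x²/2}`. -/
noncomputable def gaussMoment (k : ℕ) : ℝ :=
  (2 : ℝ) ^ ((2 * (k : ℝ) - 1) / 2) * Real.Gamma ((2 * (k : ℝ) + 1) / 2)

theorem gaussMoment_zero : gaussMoment 0 * √(2 * Real.pi) = Real.pi := by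
  have h1 : (2 * ((0 : ℕ) : ℝ) + 1) / 2 = 1 / 2 := by norm_num
  have h2 : (2 * ((0 : ℕ) : ℝ) - 1) / 2 = -(1 / 2) := by norm_num
  rw [gaussMoment, h1, h2, Real.Gamma_one_half_eq, Real.sqrt_mul (by norm_num),
    Real.rpow_neg (by norm_num), ← Real.sqrt_eq_rpow]
  have h3 : √(2 : ℝ) ≠ 0 := by positivity
  have h4 := Real.mul_self_sqrt Real.pi_pos.le
  field_simp
  linear_combination h4

theorem gaussMoment_succ (k : ℕ) : gaussMoment (k + 1) = (2 * k + 1) * gaussMoment k := by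
  have h1 : (2 * ((k + 1 : ℕ) : ℝ) + 1) / 2 = (2 * (k : ℝ) + 1) / 2 + 1 := by push_cast; ring
  have h2 : (2 * ((k + 1 : ℕ) : ℝ) - 1) / 2 = (2 * (k : ℝ) - 1) / 2 + 1 := by push_cast; ring
  rw [gaussMoment, gaussMoment, h1, h2, Real.Gamma_add_one (by positivity),
    Real.rpow_add_one (by norm_num)]
  ring

/-- The real factor of the sum of Bessel functions of half-integral order. -/
noncomputable def besselSumReal (n : ℕ) (x : ℝ) : ℝ :=
  ∑ k ∈ Finset.range (n + 1), (n.choose (2 * k) : ℝ) * (-1) ^ k * gaussMoment k *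
    x ^ (n - 2 * k) * (1 / 2 * besselInt ((n : ℝ) - k - 1 / 2) (x ^ 2))

theorem hasDerivAt_besselSumReal (n : ℕ) {x : ℝ} (hx : 0 < x) :
    HasDerivAt (besselSumReal n) (-besselSumReal (n + 1) x) x := by
  have hd : HasDerivAt (besselSumReal n) (∑ k ∈ Finset.range (n + 1),
      ((n.choose (2 * k) : ℝ) * (-1) ^ k * gaussMoment k * (((n - 2 * k : ℕ) : ℝ) *
        x ^ (n - 2 * k - 1)) * (1 / 2 * besselInt ((n : ℝ) - k - 1 / 2) (x ^ 2)) +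
      (n.choose (2 * k) : ℝ) * (-1) ^ k * gaussMoment k * x ^ (n - 2 * k) *
        (1 / 2 * -(x * besselInt ((n : ℝ) - k - 1 / 2 + 1) (x ^ 2))))) x := by
    refine HasDerivAt.fun_sum fun k _ => ?_
    exact ((hasDerivAt_pow (n - 2 * k) x).const_mul _).mul
      ((hasDerivAt_besselInt_sq _ hx).const_mul _)
  refine hd.congr_deriv ?_
  -- Pascal's rule splits S_{n+1}: `a` collects the binomials C(n, 2k), and `b` the binomials C(n,
  -- 2k+1) with the index shifted by one. They match the derivative of the Bessel factor and of the
  -- power of x, respectively.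
  let E : ℕ → ℝ := fun k => 1 / 2 * besselInt (((n + 1 : ℕ) : ℝ) - k - 1 / 2) (x ^ 2)
  let a : ℕ → ℝ := fun k => (n.choose (2 * k) : ℝ) * (-1) ^ k * gaussMoment k *
    x ^ (n + 1 - 2 * k) * E k
  let b : ℕ → ℝ := fun k => (n.choose (2 * k + 1) : ℝ) * (-1) ^ (k + 1) * gaussMoment (k + 1) *
    x ^ (n + 1 - 2 * (k + 1)) * E (k + 1)
  have h1 : besselSumReal (n + 1) x =
      ∑ k ∈ Finset.range (n + 1), (a k + b k) := by
    rw [besselSumReal, Finset.sum_range_succ', Finset.sum_add_distrib]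
    have h2 : ∑ k ∈ Finset.range (n + 1), a k = ∑ k ∈ Finset.range (n + 1), a (k + 1) + a 0 := by
      rw [← Finset.sum_range_succ', Finset.sum_range_succ _ (n + 1)]
      simp only [a]
      rw [Nat.choose_eq_zero_of_lt (by omega : n < 2 * (n + 1))]
      simp
    rw [h2, add_right_comm, ← Finset.sum_add_distrib]
    congr 1
    · refine Finset.sum_congr rfl fun k _ => ?_
      have hc : (n + 1).choose (2 * (k + 1)) = n.choose (2 * k + 1) + n.choose (2 * (k + 1)) := by
        rw [show 2 * (k + 1) = (2 * k + 1) + 1 by ring, Nat.choose_succ_succ]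
      simp only [a, b, E]
      rw [hc]; push_cast; ring
    · simp [a, E]
  rw [h1, ← Finset.sum_neg_distrib]
  refine Finset.sum_congr rfl fun k _ => ?_
  have e1 : E k = 1 / 2 * besselInt ((n : ℝ) - k - 1 / 2 + 1) (x ^ 2) := by
    simp only [E]; congr 2; push_cast; ring
  have e2 : E (k + 1) = 1 / 2 * besselInt ((n : ℝ) - k - 1 / 2) (x ^ 2) := by
    simp only [E]; congr 2; push_cast; ring
  simp only [a, b]
  rw [e1, e2, gaussMoment_succ]
  -- For n < 2k both binomials vanish, so truncated subtraction does no harm. Otherwise (2k+1)C(n,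
  -- 2k+1) = (n-2k)C(n, 2k), and the factor 2k+1 comes from the moment recursion.
  rcases Nat.lt_or_ge n (2 * k) with h | h
  · rw [Nat.choose_eq_zero_of_lt h, Nat.choose_eq_zero_of_lt (by omega : n < 2 * k + 1)]
    simp
  · have hc : (n.choose (2 * k + 1) : ℝ) * (2 * k + 1) = n.choose (2 * k) * ((n - 2 * k : ℕ) : ℝ) := by
      exact_mod_cast Nat.choose_succ_right_eq n (2 * k)
    have p1 : n + 1 - 2 * k = (n - 2 * k) + 1 := by omega
    have p2 : n + 1 - 2 * (k + 1) = n - 2 * k - 1 := by omega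
    rw [p1, p2, pow_succ x (n - 2 * k)]
    linear_combination (-((-1) ^ k * gaussMoment k * x ^ (n - 2 * k - 1) *
      (1 / 2 * besselInt ((n : ℝ) - k - 1 / 2) (x ^ 2)))) * hc

theorem besselSumReal_eq (n : ℕ) {x : ℝ} (hx : 0 < x) :
    besselSumReal n x = Real.pi / 2 * Real.exp (-x) := by
  induction n generalizing x with
  | zero =>
    have h := besselInt_neg_half hx
    have h0 := gaussMoment_zero
    have e : ((0 : ℕ) : ℝ) - ((0 : ℕ) : ℝ) - 1 / 2 = -1 / 2 := by norm_num
    rw [besselSumReal, Finset.sum_range_one, e, h]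
    simp only [mul_zero, Nat.choose_zero_right, Nat.cast_one, pow_zero]
    linear_combination (1 / 2 * Real.exp (-x)) * h0
  | succ n ih =>
    have h1 := hasDerivAt_besselSumReal n hx
    have h2 : HasDerivAt (besselSumReal n) (Real.pi / 2 * (Real.exp (-x) * -1)) x :=
      ((hasDerivAt_neg x).exp.const_mul _).congr_of_eventuallyEq
        (Filter.eventually_of_mem (Ioi_mem_nhds hx) fun y hy => ih hy)
    have := h1.unique h2
    linarith

/-- For v ≠ 0 the number i·sgn(v) squares to -1 and its |v|-th power is i^v. For v = 0 the base is
0, but k = 0 and the value is 0^0 = 1. -/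
theorem sign_mul_pow {v : ℤ} {k : ℕ} (hk : 2 * k ≤ v.natAbs) :
    (Complex.I * (v.sign : ℂ)) ^ (v.natAbs - 2 * k) = (-1) ^ k * Complex.I ^ v := by
  have hI : (-1 : ℂ) ^ k * (-1) ^ k = 1 := by rw [← mul_pow]; simp
  have key : ∀ (z : ℂ) (n : ℕ), z ^ 2 = -1 → 2 * k ≤ n → z ^ (n - 2 * k) = (-1) ^ k * z ^ n := by
    intro z n hz h
    obtain ⟨m, rfl⟩ := Nat.exists_eq_add_of_le h
    rw [Nat.add_sub_cancel_left, pow_add, pow_mul, hz, ← mul_assoc, hI, one_mul]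
  rcases lt_trichotomy v 0 with h | rfl | h
  · obtain ⟨n, hn⟩ := Int.eq_ofNat_of_zero_le (by omega : 0 ≤ -v)
    obtain rfl : v = -(n : ℤ) := by omega
    rw [Int.sign_eq_neg_one_of_neg h, Int.natAbs_neg, Int.natAbs_natCast] at *
    rw [key _ _ (by simp) hk, zpow_neg, zpow_natCast, ← inv_pow, Complex.inv_I]
    simp
  · obtain rfl : k = 0 := by simpa using hk
    simp
  · obtain ⟨n, hn⟩ := Int.eq_ofNat_of_zero_le h.le
    rw [Int.sign_eq_one_of_pos h]
    subst hn
    rw [Int.natAbs_natCast] at *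
    rw [Int.cast_one, mul_one, key _ _ (by simp) hk, zpow_natCast]

theorem besselSum_eq (v : ℤ) {x : ℝ} (hx : 0 < x) :
    besselSum v x = ((Real.pi / 2 * Real.exp (-x) : ℝ) : ℂ) * Complex.I ^ v := by
  rw [← besselSumReal_eq v.natAbs hx, besselSumReal, besselSum]
  have hsub : Finset.range (v.natAbs / 2 + 1) ⊆ Finset.range (v.natAbs + 1) :=
    Finset.range_subset_range.2 (by omega)
  rw [← Finset.sum_subset hsub]
  · rw [Complex.ofReal_sum, Finset.sum_mul]
    refine Finset.sum_congr rfl fun k hk => ?_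
    have hk : 2 * k ≤ v.natAbs := by
      have := Finset.mem_range.1 hk
      omega
    -- The denominator X^ν cancels the power x^ν produced by `besselK_eq`.
    rw [mul_pow, sign_mul_pow hk, besselK_eq _ hx, ← mul_assoc (_ / _),
      div_mul_cancel₀ _ (by positivity)]
    have e : (v.natAbs : ℝ) - (2 * (k : ℝ) + 1) / 2 = (v.natAbs : ℝ) - k - 1 / 2 := by ring
    rw [e, ← gaussMoment]
    push_cast
    ring
  · intro k _ hk
    have : v.natAbs < 2 * k := by
      have := Finset.mem_range.not.1 hk
      omega
    rw [Nat.choose_eq_zero_of_lt this]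
    simp

/-! ### Gaussian moments and Fubini for the Bessel integral. -/

theorem integrable_pow_mul_gauss (j : ℕ) {t : ℝ} (ht : 0 < t) :
    Integrable fun x : ℝ => x ^ j * Real.exp (-(t / 2) * x ^ 2) := by
  have h := integrable_rpow_mul_exp_neg_mul_sq (b := t / 2) (by positivity) (s := (j : ℝ))
    (by have := Nat.cast_nonneg (α := ℝ) j; linarith)
  simpa only [Real.rpow_natCast] using h

theorem integral_abs_pow_mul_gauss (j : ℕ) {t : ℝ} (ht : 0 < t) :
    ∫ x : ℝ, |x| ^ j * Real.exp (-(t / 2) * x ^ 2) =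
      (t / 2) ^ (-((j : ℝ) + 1) / 2) * Real.Gamma (((j : ℝ) + 1) / 2) := by
  have h := integral_comp_abs (f := fun x : ℝ => x ^ j * Real.exp (-(t / 2) * x ^ 2))
  simp only [sq_abs] at h
  have h2 := integral_rpow_mul_exp_neg_mul_rpow (p := 2) (q := (j : ℝ)) (b := t / 2) two_pos
    (by have := Nat.cast_nonneg (α := ℝ) j; linarith) (by positivity)
  have h3 : ∫ x in Set.Ioi (0 : ℝ), x ^ j * Real.exp (-(t / 2) * x ^ 2) =
      ∫ x in Set.Ioi (0 : ℝ), x ^ (j : ℝ) * Real.exp (-(t / 2) * x ^ (2 : ℝ)) := by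
    simp only [Real.rpow_natCast, Real.rpow_two]
  rw [h, h3, h2]
  ring

/-- The moment `∫ x^j e^{-x²/2}`. -/
noncomputable def moment (j : ℕ) : ℝ :=
  if Even j then (1 / 2 : ℝ) ^ (-((j : ℝ) + 1) / 2) * Real.Gamma (((j : ℝ) + 1) / 2) else 0

theorem moment_two_mul (k : ℕ) : moment (2 * k) = 2 * gaussMoment k := by
  rw [moment, if_pos (even_two_mul k), gaussMoment, one_div, Real.inv_rpow (by norm_num),
    ← Real.rpow_neg (by norm_num)]
  push_cast
  have : -(-(2 * (k : ℝ) + 1) / 2) = (2 * (k : ℝ) - 1) / 2 + 1 := by ring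
  rw [this, Real.rpow_add_one (by norm_num)]
  ring

theorem moment_odd (k : ℕ) : moment (2 * k + 1) = 0 := if_neg (by simp)

theorem integral_pow_mul_gauss (j : ℕ) {t : ℝ} (ht : 0 < t) :
    ∫ x : ℝ, x ^ j * Real.exp (-(t / 2) * x ^ 2) = t ^ (-((j : ℝ) + 1) / 2) * moment j := by
  rw [moment]
  split_ifs with h
  · have hx : ∀ x : ℝ, x ^ j = |x| ^ j := fun x => (h.pow_abs x).symm
    rw [integral_congr_ae (.of_forall fun x =>
        congrArg (· * Real.exp (-(t / 2) * x ^ 2)) (hx x)), integral_abs_pow_mul_gauss j ht, div_eq_mul_one_div t, Real.mul_rpow ht.le (by norm_num),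
      mul_assoc]
  · have h' : Odd j := Nat.not_even_iff_odd.1 h
    have h1 := integral_neg_eq_self (fun x : ℝ => x ^ j * Real.exp (-(t / 2) * x ^ 2)) volume
    simp only [h'.neg_pow, neg_sq, neg_mul, integral_neg] at h1
    simp only [neg_mul, mul_zero]
    linarith

/-- For fixed t the kernel is a Gaussian moment in x. Its absolute integral is a constant times
t^{-(j+1)/2}, so what remains is a `besselInt` integrand of order ν - (j+1)/2, integrable because a
> 0. -/
theorem integrable_moment_kernel (j : ℕ) (ν : ℝ) {a : ℝ} (ha : 0 < a) :
    Integrable (fun p : ℝ × ℝ => p.1 ^ j *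
      (p.2 ^ (ν - 1) * Real.exp (-(((p.1 ^ 2 + a) * p.2 + p.2⁻¹) / 2))))
      (volume.prod (volume.restrict (Set.Ioi (0 : ℝ)))) := by
  have hsplit : ∀ x t : ℝ, x ^ j * (t ^ (ν - 1) * Real.exp (-(((x ^ 2 + a) * t + t⁻¹) / 2))) =
      t ^ (ν - 1) * Real.exp (-((a * t + t⁻¹) / 2)) * (x ^ j * Real.exp (-(t / 2) * x ^ 2)) := by
    intro x t
    have : Real.exp (-(((x ^ 2 + a) * t + t⁻¹) / 2)) =
        Real.exp (-((a * t + t⁻¹) / 2)) * Real.exp (-(t / 2) * x ^ 2) := by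
      rw [← Real.exp_add]; congr 1; ring
    rw [this]; ring
  refine (integrable_prod_iff' (by fun_prop)).2 ⟨?_, ?_⟩
  · refine (ae_restrict_iff' measurableSet_Ioi).2 (.of_forall fun t ht => ?_)
    simp only [hsplit]
    exact (integrable_pow_mul_gauss j ht).const_mul _
  · have h1 := (integrableOn_besselInt (ν - ((j : ℝ) + 1) / 2) ha).mul_const
      ((1 / 2 : ℝ) ^ (-((j : ℝ) + 1) / 2) * Real.Gamma (((j : ℝ) + 1) / 2))
    refine IntegrableOn.congr_fun h1 (fun t ht => ?_) measurableSet_Ioi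
    have ht : 0 < t := ht
    simp only [hsplit]
    have hn : ∀ x : ℝ, ‖t ^ (ν - 1) * Real.exp (-((a * t + t⁻¹) / 2)) *
        (x ^ j * Real.exp (-(t / 2) * x ^ 2))‖ = t ^ (ν - 1) * Real.exp (-((a * t + t⁻¹) / 2)) *
        (|x| ^ j * Real.exp (-(t / 2) * x ^ 2)) := by
      intro x
      rw [norm_mul, norm_mul _ (Real.exp (-(t / 2) * x ^ 2)), norm_pow, Real.norm_eq_abs x,
        Real.norm_of_nonneg (by positivity), Real.norm_of_nonneg (by positivity)]
    simp only [hn]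
    rw [integral_const_mul, integral_abs_pow_mul_gauss j ht, div_eq_mul_one_div t,
      Real.mul_rpow ht.le (by norm_num)]
    have : ν - ((j : ℝ) + 1) / 2 - 1 = (ν - 1) + -((j : ℝ) + 1) / 2 := by ring
    rw [this, Real.rpow_add ht]
    ring

theorem integrable_pow_mul_besselInt (j : ℕ) (ν : ℝ) {a : ℝ} (ha : 0 < a) :
    Integrable fun x : ℝ => x ^ j * besselInt ν (x ^ 2 + a) := by
  have h := (integrable_moment_kernel j ν ha).integral_prod_left
  simp only [integral_const_mul] at h
  exact h

theorem integral_pow_mul_besselInt (j : ℕ) (ν : ℝ) {a : ℝ} (ha : 0 < a) :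
    ∫ x : ℝ, x ^ j * besselInt ν (x ^ 2 + a) =
      moment j * besselInt (ν - ((j : ℝ) + 1) / 2) a := by
  have h := integral_integral_swap (f := fun x t : ℝ => x ^ j *
      (t ^ (ν - 1) * Real.exp (-(((x ^ 2 + a) * t + t⁻¹) / 2)))) (integrable_moment_kernel j ν ha)
  simp only [integral_const_mul] at h
  change ∫ x : ℝ, x ^ j * besselInt ν (x ^ 2 + a) = _ at h
  rw [h, besselInt, ← integral_const_mul]
  refine setIntegral_congr_fun measurableSet_Ioi fun t ht => ?_
  have ht : 0 < t := ht
  have hsplit : ∀ x : ℝ, x ^ j * (t ^ (ν - 1) * Real.exp (-(((x ^ 2 + a) * t + t⁻¹) / 2))) =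
      t ^ (ν - 1) * Real.exp (-((a * t + t⁻¹) / 2)) * (x ^ j * Real.exp (-(t / 2) * x ^ 2)) := by
    intro x
    have : Real.exp (-(((x ^ 2 + a) * t + t⁻¹) / 2)) =
        Real.exp (-((a * t + t⁻¹) / 2)) * Real.exp (-(t / 2) * x ^ 2) := by
      rw [← Real.exp_add]; congr 1; ring
    rw [this]; ring
  simp only [hsplit]
  rw [integral_const_mul, integral_pow_mul_gauss j ht]
  have : ν - ((j : ℝ) + 1) / 2 - 1 = (ν - 1) + -((j : ℝ) + 1) / 2 := by ring
  rw [this, Real.rpow_add ht]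
  ring

/-! ### Integration of the Bessel phase along a horizontal line. -/

theorem sum_range_two_mul {M : Type*} [AddCommMonoid M] (f : ℕ → M) (n : ℕ) :
    ∑ j ∈ Finset.range (2 * n), f j = ∑ k ∈ Finset.range n, (f (2 * k) + f (2 * k + 1)) := by
  induction n with
  | zero => simp
  | succ n ih =>
    rw [show 2 * (n + 1) = 2 * n + 1 + 1 by ring, Finset.sum_range_succ, Finset.sum_range_succ, ih,
      Finset.sum_range_succ, add_assoc]

/-- The function `(z / |z|)^v K_v (|z|)` on the complex plane. -/
noncomputable def besselPhase (v : ℤ) (z : ℂ) : ℂ :=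
  (z / (‖z‖ : ℂ)) ^ v * (besselK (v : ℝ) ‖z‖ : ℂ)

/-- The factor |z|^{-n} of the phase cancels the |z|^n of `besselK_eq`, leaving a polynomial in z
times a function of |z|². -/
theorem besselPhase_natCast (n : ℕ) {z : ℂ} (hz : z ≠ 0) :
    besselPhase n z = z ^ n * ((1 / 2 * besselInt n (‖z‖ ^ 2) : ℝ) : ℂ) := by
  have h : 0 < ‖z‖ := norm_pos_iff.2 hz
  have h' : (‖z‖ : ℂ) ≠ 0 := by exact_mod_cast h.ne'
  rw [besselPhase, zpow_natCast, Int.cast_natCast, besselK_eq _ h, Real.rpow_natCast, div_pow]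
  push_cast
  field_simp

/-- The phase has modulus one, so its inverse is its conjugate, while K_v is real and even in v. -/
theorem besselPhase_neg (v : ℤ) {z : ℂ} (hz : z ≠ 0) :
    besselPhase (-v) z = (starRingEnd ℂ) (besselPhase v z) := by
  have h' : (‖z‖ : ℂ) ≠ 0 := by exact_mod_cast (norm_pos_iff.2 hz).ne'
  have h1 : (z / (‖z‖ : ℂ))⁻¹ = (starRingEnd ℂ) (z / (‖z‖ : ℂ)) := by
    refine inv_eq_of_mul_eq_one_right ?_
    rw [Complex.mul_conj, Complex.normSq_eq_norm_sq, norm_div]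
    simp [hz]
  rw [besselPhase, besselPhase, zpow_neg, ← inv_zpow, h1, map_mul, map_zpow₀, Complex.conj_ofReal,
    Int.cast_neg, besselK_neg]

theorem besselPhase_line (n : ℕ) {a : ℝ} (ha : 0 < a) (x : ℝ) :
    besselPhase n (-(x : ℂ) + (a : ℂ) * Complex.I) = ∑ j ∈ Finset.range (n + 1),
      ((n.choose j : ℂ) * (-1) ^ j * ((a : ℂ) * Complex.I) ^ (n - j) * (1 / 2)) *
        ((x ^ j * besselInt n (x ^ 2 + a ^ 2) : ℝ) : ℂ) := by
  have hz : -(x : ℂ) + (a : ℂ) * Complex.I ≠ 0 := by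
    intro h
    have := congrArg Complex.im h
    simp at this
    linarith
  have hn : ‖-(x : ℂ) + (a : ℂ) * Complex.I‖ ^ 2 = x ^ 2 + a ^ 2 := by
    rw [← Complex.normSq_eq_norm_sq, Complex.normSq_apply]
    simp; ring
  rw [besselPhase_natCast n hz, hn, add_pow, Finset.sum_mul]
  refine Finset.sum_congr rfl fun j _ => ?_
  rw [neg_pow]
  push_cast
  ring

theorem besselPhase_natCast_integral (n : ℕ) {a : ℝ} (ha : 0 < a) :
    Integrable (fun x : ℝ => besselPhase n (-(x : ℂ) + (a : ℂ) * Complex.I)) ∧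
      ∫ x : ℝ, besselPhase n (-(x : ℂ) + (a : ℂ) * Complex.I) =
        ((Real.pi * Real.exp (-a) : ℝ) : ℂ) * Complex.I ^ n := by
  have ha2 : 0 < a ^ 2 := by positivity
  simp only [besselPhase_line n ha]
  have hint : ∀ j ∈ Finset.range (n + 1), Integrable fun x : ℝ =>
      ((n.choose j : ℂ) * (-1) ^ j * ((a : ℂ) * Complex.I) ^ (n - j) * (1 / 2)) *
        ((x ^ j * besselInt n (x ^ 2 + a ^ 2) : ℝ) : ℂ) := fun j _ =>
    (integrable_pow_mul_besselInt j n ha2).ofReal.const_mul _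
  refine ⟨integrable_finsetSum _ hint, ?_⟩
  rw [integral_finsetSum _ hint]
  have hval : ∀ j : ℕ, ∫ x : ℝ, ((x ^ j * besselInt n (x ^ 2 + a ^ 2) : ℝ) : ℂ) =
      ((moment j * besselInt (n - ((j : ℝ) + 1) / 2) (a ^ 2) : ℝ) : ℂ) := fun j => by
    rw [integral_complex_ofReal, integral_pow_mul_besselInt j n ha2]
  simp only [integral_const_mul, hval]
  -- Padding with zero binomials allows the terms to be paired as (2k, 2k+1); the odd moments
  -- vanish, and the even ones reproduce `besselSumReal n a`.
  rw [Finset.sum_subset (s₂ := Finset.range (2 * (n + 1)))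
    (Finset.range_subset_range.2 (by omega)), sum_range_two_mul]
  · have h := besselSumReal_eq n ha
    have h2 : Real.pi * Real.exp (-a) = 2 * besselSumReal n a := by rw [h]; ring
    rw [h2, besselSumReal]
    rw [Complex.ofReal_mul, Complex.ofReal_sum, Finset.mul_sum, Finset.sum_mul]
    refine Finset.sum_congr rfl fun k _ => ?_
    rw [moment_odd, moment_two_mul]
    rcases Nat.lt_or_ge n (2 * k) with hk | hk
    · rw [Nat.choose_eq_zero_of_lt hk]; simp
    · have hI : Complex.I ^ (n - 2 * k) = (-1) ^ k * Complex.I ^ n := by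
        obtain ⟨m, rfl⟩ := Nat.exists_eq_add_of_le hk
        rw [Nat.add_sub_cancel_left, pow_add, pow_mul, Complex.I_sq, ← mul_assoc, ← mul_pow]
        simp
      have e : (n : ℝ) - (((2 * k : ℕ) : ℝ) + 1) / 2 = (n : ℝ) - k - 1 / 2 := by push_cast; ring
      rw [zero_mul, Complex.ofReal_zero, mul_zero, add_zero, e, mul_pow, hI, pow_mul]
      push_cast
      ring
  · intro j _ hj
    rw [Nat.choose_eq_zero_of_lt (by have := Finset.mem_range.not.1 hj; omega)]
    simp

theorem besselPhase_integral (v : ℤ) {a : ℝ} (ha : 0 < a) :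
    Integrable (fun x : ℝ => besselPhase v (-(x : ℂ) + (a : ℂ) * Complex.I)) ∧
      ∫ x : ℝ, besselPhase v (-(x : ℂ) + (a : ℂ) * Complex.I) =
        ((Real.pi * Real.exp (-a) : ℝ) : ℂ) * Complex.I ^ v := by
  obtain ⟨n, rfl | rfl⟩ := v.eq_nat_or_neg
  · exact_mod_cast besselPhase_natCast_integral n ha
  · obtain ⟨h1, h2⟩ := besselPhase_natCast_integral n ha
    have hz : ∀ x : ℝ, -(x : ℂ) + (a : ℂ) * Complex.I ≠ 0 := by
      intro x h
      have := congrArg Complex.im h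
      simp at this
      linarith
    simp only [besselPhase_neg _ (hz _)]
    refine ⟨(Complex.conjCLE.toContinuousLinearMap.integrable_comp h1), ?_⟩
    rw [integral_conj, h2, map_mul, Complex.conj_ofReal, map_pow, Complex.conj_I, zpow_neg,
      zpow_natCast, ← inv_pow, Complex.inv_I]

/-! ### Lorentzian geometry of V_{1,n}. -/

namespace SplitSpace

variable {V : Type*} [NormedAddCommGroup V] [NormedSpace ℝ V] (D : SplitSpace V)

theorem pair_comm (x y : V) : D.pair x y = D.pair y x := QuadraticMap.polar_comm _ x y

theorem pair_add_left (x y z : V) : D.pair (x + y) z = D.pair x z + D.pair y z :=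
  QuadraticMap.polar_add_left _ x y z

theorem pair_add_right (x y z : V) : D.pair x (y + z) = D.pair x y + D.pair x z :=
  QuadraticMap.polar_add_right _ x y z

theorem pair_sub_left (x y z : V) : D.pair (x - y) z = D.pair x z - D.pair y z :=
  QuadraticMap.polar_sub_left _ x y z

theorem pair_sub_right (x y z : V) : D.pair x (y - z) = D.pair x y - D.pair x z :=
  QuadraticMap.polar_sub_right _ x y z

theorem pair_smul_left (a : ℝ) (x y : V) : D.pair (a • x) y = a * D.pair x y :=
  QuadraticMap.polar_smul_left _ a x y

theorem pair_smul_right (a : ℝ) (x y : V) : D.pair x (a • y) = a * D.pair x y :=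
  QuadraticMap.polar_smul_right _ a x y

theorem pair_neg_right (x y : V) : D.pair x (-y) = -D.pair x y :=
  QuadraticMap.polar_neg_right _ x y

theorem pair_self (x : V) : D.pair x x = 2 * D.q x := by
  rw [pair, QuadraticMap.polar_self, nsmul_eq_mul, Nat.cast_ofNat]

theorem pair_b_b (i j : Fin 4) : D.pair (D.b i) (D.b j) = 0 := D.b_b i j

theorem pair_b'_b' (i j : Fin 4) : D.pair (D.b' i) (D.b' j) = 0 := D.b'_b' i j

theorem pair_b_b' (i j : Fin 4) : D.pair (D.b i) (D.b' j) = if i = j then 1 else 0 := D.b_b' i j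

theorem pair_b'_b (i j : Fin 4) : D.pair (D.b' i) (D.b j) = if i = j then 1 else 0 := by
  rw [pair_comm, pair_b_b']; simp [eq_comm]

theorem memV2n_y₀ : D.MemV2n D.y₀ := by
  simp [MemV2n, y₀, pair_add_left, pair_b_b, pair_b_b', pair_b'_b, pair_b'_b']

theorem memV1n_y₁ : D.MemV1n D.y₁ := by
  simp [MemV1n, MemV2n, y₁, y₀, pair_add_left, pair_add_right, pair_b_b, pair_b_b', pair_b'_b,
    pair_b'_b']

theorem pair_y₀_y₀ : D.pair D.y₀ D.y₀ = 2 := by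
  norm_num [y₀, pair_add_left, pair_add_right, pair_b_b, pair_b_b', pair_b'_b, pair_b'_b']

theorem pair_y₁_y₁ : D.pair D.y₁ D.y₁ = 2 := by
  norm_num [y₁, pair_add_left, pair_add_right, pair_b_b, pair_b_b', pair_b'_b, pair_b'_b']

variable {D} in
theorem MemV1n.sub_smul {x y : V} (hx : D.MemV1n x) (hy : D.MemV1n y) (a c : ℝ) :
    D.MemV1n (a • x - c • y) := by
  obtain ⟨⟨h1, h2, h3, h4⟩, h5⟩ := hx
  obtain ⟨⟨k1, k2, k3, k4⟩, k5⟩ := hy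
  simp [MemV1n, MemV2n, pair_sub_left, pair_smul_left, *]

/-- `V_{1,n}` is negative semidefinite on the orthogonal complement of `y_1`. -/
theorem pair_self_nonpos {x : V} (hx : D.MemV1n x) (hy : D.pair x D.y₁ = 0) : D.pair x x ≤ 0 := by
  obtain ⟨⟨h1, h2, h3, h4⟩, h5⟩ := hx
  rw [y₀, pair_add_right] at h5
  rw [y₁, pair_add_right] at hy
  let a := D.pair x (D.b 2)
  let c := D.pair x (D.b 3)
  have ha : D.pair x (D.b' 2) = -a := by simp only [a]; linarith
  have hc : D.pair x (D.b' 3) = -c := by simp only [c]; linarith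
  -- Orthogonality to y₀ and y₁ makes the hyperbolic components of x multiples of b₃ - b₋₃ and b₄ -
  -- b₋₄, both of negative norm; z is the component in the negative definite complement.
  let z := x - (-a) • D.b 2 - a • D.b' 2 - (-c) • D.b 3 - c • D.b' 3
  have hb : ∀ i, D.pair z (D.b i) = 0 := by
    intro i
    simp only [z, pair_sub_left, pair_smul_left, pair_b_b, pair_b'_b]
    fin_cases i <;> simp [h1, h2, a, c]
  have hb' : ∀ i, D.pair z (D.b' i) = 0 := by
    intro i
    simp only [z, pair_sub_left, pair_smul_left, pair_b'_b', pair_b_b']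
    fin_cases i <;> simp [h3, h4, ha, hc]
  have hz : D.pair z z ≤ 0 := by
    by_cases h0 : z = 0
    · rw [h0, pair_self]; simp
    · rw [pair_self]; linarith [D.neg z hb hb' h0]
  have hx : x = z + (-a) • D.b 2 + a • D.b' 2 + (-c) • D.b 3 + c • D.b' 3 := by
    simp only [z]; abel
  have hbz : ∀ i, D.pair (D.b i) z = 0 := fun i => by rw [pair_comm, hb]
  have hbz' : ∀ i, D.pair (D.b' i) z = 0 := fun i => by rw [pair_comm, hb']
  have : D.pair x x = D.pair z z - 2 * a ^ 2 - 2 * c ^ 2 := by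
    rw [hx]
    simp only [pair_add_left, pair_add_right, pair_smul_left, pair_smul_right, hb, hb', hbz, hbz',
      pair_b_b, pair_b_b', pair_b'_b, pair_b'_b']
    simp
    ring
  rw [this]
  nlinarith [sq_nonneg a, sq_nonneg c]

/-- Two vectors of positive norm in the Lorentzian space `V_{1,n}` are not orthogonal. -/
theorem pair_ne_zero {x y : V} (hx : D.MemV1n x) (hy : D.MemV1n y) (hxx : 0 < D.pair x x)
    (hyy : 0 < D.pair y y) : D.pair x y ≠ 0 := by
  intro hxy
  have hyx : D.pair y x = 0 := by rw [pair_comm, hxy]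
  -- The combination (y, y₁)x - (x, y₁)y is orthogonal to y₁, yet for x ⟂ y its norm is (y, y₁)²(x,
  -- x) + (x, y₁)²(y, y). This forces (x, y₁) = 0, and then (x, x) ≤ 0.
  have h := D.pair_self_nonpos (hx.sub_smul hy (D.pair y D.y₁) (D.pair x D.y₁))
    (by rw [pair_sub_left, pair_smul_left, pair_smul_left]; ring)
  simp only [pair_sub_left, pair_sub_right, pair_smul_left, pair_smul_right, hxy, hyx] at h
  have h1 : D.pair x D.y₁ = 0 := by
    by_contra h0
    nlinarith [mul_nonneg (mul_self_nonneg (D.pair y D.y₁)) hxx.le,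
      mul_pos (mul_self_pos.2 h0) hyy]
  linarith [D.pair_self_nonpos hx h1]

variable {D} in
theorem pair_map {g : V →L[ℝ] V} (hg : ∀ x, D.q (g x) = D.q x) (x y : V) :
    D.pair (g x) (g y) = D.pair x y := by
  rw [pair, pair, QuadraticMap.polar, QuadraticMap.polar, ← map_add, hg, hg, hg]

variable {D} in
theorem memV1n_map_y₁ {u : V →L[ℝ] V} (hu : u ∈ D.SO1n) : D.MemV1n (u D.y₁) := by
  obtain ⟨⟨hq, -⟩, h0, h1, h2, h3, h4⟩ := hu
  obtain ⟨⟨k1, k2, k3, k4⟩, k5⟩ := D.memV1n_y₁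
  refine ⟨⟨?_, ?_, ?_, ?_⟩, ?_⟩
  · rw [← h0, pair_map hq, k1]
  · rw [← h1, pair_map hq, k2]
  · rw [← h2, pair_map hq, k3]
  · rw [← h3, pair_map hq, k4]
  · rw [← h4, pair_map hq, k5]

theorem one_mem_SO : (1 : V →L[ℝ] V) ∈ D.SO := ⟨fun _ => rfl, LinearMap.det_id⟩

variable {D} in
theorem mul_mem_SO {g h : V →L[ℝ] V} (hg : g ∈ D.SO) (hh : h ∈ D.SO) : g * h ∈ D.SO := by
  refine ⟨fun x => ?_, ?_⟩
  · rw [mul_apply_eq_comp, hg.1, hh.1]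
  · have : ((g * h : V →L[ℝ] V) : V →ₗ[ℝ] V) = (g : V →ₗ[ℝ] V) ∘ₗ (h : V →ₗ[ℝ] V) := rfl
    rw [this, LinearMap.det_comp, hg.2, hh.2, one_mul]

theorem one_mem_SO1n : (1 : V →L[ℝ] V) ∈ D.SO1n := ⟨D.one_mem_SO, rfl, rfl, rfl, rfl, rfl⟩

theorem one_mem_SO1n0 : (1 : V →L[ℝ] V) ∈ D.SO1n0 := mem_connectedComponentIn D.one_mem_SO1n

variable {D} in
theorem SO1n0_subset : D.SO1n0 ⊆ D.SO1n := connectedComponentIn_subset _ _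

variable {D} in
theorem pair_inverse {g : V →L[ℝ] V} (hg : g ∈ D.SO) (hu : IsUnit g) (x y : V) :
    D.pair (Ring.inverse g x) y = D.pair x (g y) := by
  have h : g (Ring.inverse g x) = x := by
    rw [← mul_apply_eq_comp, Ring.mul_inverse_cancel _ hu]; rfl
  rw [← pair_map hg.1, h]

variable [FiniteDimensional ℝ V]

theorem continuous_pair_right (x : V) : Continuous (D.pair x) :=
  (LinearMap.continuous_of_finiteDimensional (D.q.polarBilin x))

variable {D} in
/-- `SO(V_{1,n})^0` preserves the component of `y_1` in the cone of vectors of positive norm. -/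
theorem pair_map_y₁_neg {T : V} (hT : D.MemV1n T) (hpos : D.PosDef T) {u : V →L[ℝ] V}
    (hu : u ∈ D.SO1n0) : D.pair T (u D.y₁) < 0 := by
  have hne : ∀ g ∈ D.SO1n0, D.pair T (g D.y₁) ≠ 0 := fun g hg => by
    have hg := SO1n0_subset hg
    refine D.pair_ne_zero hT (memV1n_map_y₁ hg) hpos.2 ?_
    rw [pair_map hg.1.1, pair_y₁_y₁]; norm_num
  have hcont : ContinuousOn (fun g : V →L[ℝ] V => D.pair T (g D.y₁)) D.SO1n0 :=
    ((D.continuous_pair_right T).comp (continuous_id.clm_apply continuous_const)).continuousOn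
  have h1 : D.pair T D.y₁ < 0 := by
    have := hpos.1
    rw [pair_neg_right] at this
    linarith
  by_contra h
  -- A change of sign along the connected group would give g with T ⟂ g·y₁, two orthogonal vectors
  -- of positive norm.
  obtain ⟨g, hg, hg0⟩ := isPreconnected_connectedComponentIn.intermediate_value D.one_mem_SO1n0 hu
    hcont ⟨h1.le, not_lt.1 h⟩
  exact hne g hg hg0

/-! ### The Levi elements and the value of β on them. -/

theorem wedge_apply (v w x : V) : D.wedge v w x = D.pair w x • v - D.pair v x • w := rfl

/-- The unipotent element `exp (s b_1 ∧ b_{-2})`. -/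
noncomputable def unip (s : ℝ) : V →L[ℝ] V := 1 + s • D.wedge (D.b 0) (D.b' 1)

/-- The vectors b₁ and b₋₂ are isotropic and orthogonal, so the wedge squares to zero and the
exponential series stops after the linear term. -/
theorem exp_smul_wedge (s : ℝ) : NormedSpace.exp (s • D.wedge (D.b 0) (D.b' 1)) = D.unip s := by
  have h2 : (s • D.wedge (D.b 0) (D.b' 1)) ^ 2 = 0 := by
    ext x
    simp [pow_two, wedge_apply, pair_sub_right, pair_smul_right, pair_b_b, pair_b_b', pair_b'_b,
      pair_b'_b']
  rw [NormedSpace.exp_eq_tsum ℝ]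
  simp only []
  rw [tsum_eq_sum (s := Finset.range 2)]
  · simp [Finset.sum_range_succ, unip]
  · intro k hk
    obtain ⟨m, rfl⟩ := Nat.exists_eq_add_of_le (by simpa [Nat.lt_iff_add_one_le] using hk : 2 ≤ k)
    rw [pow_add, h2, zero_mul, smul_zero]

theorem unip_apply (s : ℝ) (x : V) :
    D.unip s x = x + s • (D.pair (D.b' 1) x • D.b 0 - D.pair (D.b 0) x • D.b' 1) := rfl

theorem torus_apply (t : ℝ) (x : V) :
    D.torus t x = x + ((t - 1) • D.pair (D.b' 1) x • D.b 1 +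
      (t⁻¹ - 1) • D.pair (D.b 1) x • D.b' 1) := rfl

/-- Such a map is a product of two transvections; (a, w) = 0 kills the cross term. -/
theorem det_of_apply {g : V →L[ℝ] V} {a c v w : V} (h0 : D.pair a w = 0)
    (h : ∀ x, g x = x + D.pair a x • v + D.pair c x • w) :
    LinearMap.det (g : V →ₗ[ℝ] V) = (1 + D.pair a v) * (1 + D.pair c w) := by
  have : (g : V →ₗ[ℝ] V) = LinearMap.transvection (D.q.polarBilin a) v ∘ₗ
      LinearMap.transvection (D.q.polarBilin c) w := by
    ext x
    rw [LinearMap.comp_apply, LinearMap.transvection.apply, LinearMap.transvection.apply]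
    change g x = x + D.pair c x • w + D.pair a (x + D.pair c x • w) • v
    rw [h, pair_add_right, pair_smul_right, h0, mul_zero, add_zero]
    abel
  rw [this, LinearMap.det_comp, LinearMap.transvection.det, LinearMap.transvection.det]
  rfl

theorem unip_mem_SO (s : ℝ) : D.unip s ∈ D.SO := by
  refine ⟨fun x => ?_, ?_⟩
  · have : D.pair (D.unip s x) (D.unip s x) = D.pair x x := by
      rw [unip_apply]
      simp only [pair_add_left, pair_add_right, pair_sub_left, pair_sub_right, pair_smul_left,
        pair_smul_right, pair_b_b, pair_b_b', pair_b'_b, pair_b'_b', D.pair_comm x]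
      simp
      ring
    rw [pair_self, pair_self] at this
    linarith
  · rw [D.det_of_apply (a := D.b' 1) (v := s • D.b 0) (c := D.b 0) (w := -s • D.b' 1)]
    · simp [pair_neg_right, pair_smul_right, pair_b_b', pair_b'_b]
    · simp [pair_neg_right, pair_smul_right, pair_b'_b']
    · intro x
      rw [unip_apply]
      module

theorem torus_mem_SO {t : ℝ} (ht : 0 < t) : D.torus t ∈ D.SO := by
  refine ⟨fun x => ?_, ?_⟩
  · have : D.pair (D.torus t x) (D.torus t x) = D.pair x x := by
      rw [torus_apply]
      simp only [pair_add_left, pair_add_right, pair_smul_left,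
        pair_smul_right, pair_b_b, pair_b_b', pair_b'_b, pair_b'_b', D.pair_comm x]
      simp
      field_simp
      ring
    rw [pair_self, pair_self] at this
    linarith
  · rw [D.det_of_apply (a := D.b' 1) (v := (t - 1) • D.b 1) (c := D.b 1) (w := (t⁻¹ - 1) • D.b' 1)]
    · simp [pair_smul_right, pair_b_b', pair_b'_b, ht.ne']
    · simp [pair_smul_right, pair_b'_b']
    · intro x
      rw [torus_apply]
      module

/-- The elements `exp (s b_1 ∧ b_{-2}) (t, u)` of the Levi subgroup. -/
noncomputable def leviElt (s t : ℝ) (u : V →L[ℝ] V) : V →L[ℝ] V := D.unip s * (D.torus t * u)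

variable {D} in
theorem leviElt_apply {u : V →L[ℝ] V} (s t : ℝ) (x : V) :
    D.leviElt s t u x = D.unip s (D.torus t (u x)) := rfl

section

variable {D}
variable {u : V →L[ℝ] V} {s t : ℝ}

theorem leviElt_b_zero (hu : u ∈ D.SO1n) : D.leviElt s t u (D.b 0) = D.b 0 := by
  rw [leviElt_apply, hu.2.1, torus_apply]
  simp [unip_apply, pair_b_b, pair_b'_b]

theorem leviElt_b_one (hu : u ∈ D.SO1n) :
    D.leviElt s t u (D.b 1) = t • D.b 1 + (t * s) • D.b 0 := by
  rw [leviElt_apply, hu.2.2.1, torus_apply, unip_apply]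
  simp only [pair_add_right, pair_smul_right, pair_b_b, pair_b'_b, pair_b_b']
  simp
  module

theorem leviElt_b'_zero (hu : u ∈ D.SO1n) :
    D.leviElt s t u (D.b' 0) = D.b' 0 - s • D.b' 1 := by
  rw [leviElt_apply, hu.2.2.2.1, torus_apply, unip_apply]
  simp [pair_b'_b', pair_b_b']
  module

theorem leviElt_b'_one (hu : u ∈ D.SO1n) : D.leviElt s t u (D.b' 1) = t⁻¹ • D.b' 1 := by
  rw [leviElt_apply, hu.2.2.2.2.1, torus_apply, unip_apply]
  simp only [pair_add_right, pair_smul_right, pair_b_b, pair_b'_b, pair_b_b', pair_b'_b']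
  simp
  module

theorem leviElt_of_memV2n {x : V} (hx : D.MemV2n (u x)) : D.leviElt s t u x = u x := by
  obtain ⟨h1, h2, h3, h4⟩ := hx
  rw [leviElt_apply, torus_apply, D.pair_comm _ (u x), D.pair_comm _ (u x), h2, h4]
  rw [zero_smul, zero_smul, smul_zero, smul_zero, add_zero, add_zero, unip_apply,
    D.pair_comm _ (u x), D.pair_comm _ (u x), h1, h4]
  simp

theorem leviElt_y₀ (hu : u ∈ D.SO1n) : D.leviElt s t u D.y₀ = D.y₀ := by
  rw [leviElt_of_memV2n, hu.2.2.2.2.2]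
  rw [hu.2.2.2.2.2]
  exact D.memV2n_y₀

theorem leviElt_y₁ (hu : u ∈ D.SO1n) : D.leviElt s t u D.y₁ = u D.y₁ :=
  leviElt_of_memV2n (memV1n_map_y₁ hu).1

theorem leviElt_mem_SO (ht : 0 < t) (hu : u ∈ D.SO1n) : D.leviElt s t u ∈ D.SO :=
  mul_mem_SO (D.unip_mem_SO s) (mul_mem_SO (D.torus_mem_SO ht) hu.1)

theorem leviElt_mem_MP (ht : 0 < t) (hu : u ∈ D.SO1n) : D.leviElt s t u ∈ D.MP := by
  refine ⟨leviElt_mem_SO ht hu, ?_, ?_⟩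
  · change D.U ≤ D.U.comap (D.leviElt s t u : V →ₗ[ℝ] V)
    have h0 : D.b 0 ∈ D.U := Submodule.subset_span (by simp)
    have h1 : D.b 1 ∈ D.U := Submodule.subset_span (by simp)
    refine Submodule.span_le.2 ?_
    rintro x (rfl | rfl)
    · change D.leviElt s t u (D.b 0) ∈ D.U
      rwa [leviElt_b_zero hu]
    · change D.leviElt s t u (D.b 1) ∈ D.U
      rw [leviElt_b_one hu]
      exact add_mem (Submodule.smul_mem _ _ h1) (Submodule.smul_mem _ _ h0)
  · change D.Udual ≤ D.Udual.comap (D.leviElt s t u : V →ₗ[ℝ] V)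
    have h0 : D.b' 0 ∈ D.Udual := Submodule.subset_span (by simp)
    have h1 : D.b' 1 ∈ D.Udual := Submodule.subset_span (by simp)
    refine Submodule.span_le.2 ?_
    rintro x (rfl | rfl)
    · change D.leviElt s t u (D.b' 0) ∈ D.Udual
      rw [leviElt_b'_zero hu]
      exact sub_mem h0 (Submodule.smul_mem _ _ h1)
    · change D.leviElt s t u (D.b' 1) ∈ D.Udual
      rw [leviElt_b'_one hu]
      exact Submodule.smul_mem _ _ h1

/-- The parameter space ℝ × (0, ∞) × SO(V_{1,n})⁰ is connected, its image lies in M_P, and (0, 1, 1)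
maps to the identity. -/
theorem leviElt_mem_MP0 (ht : 0 < t) (hu : u ∈ D.SO1n0) : D.leviElt s t u ∈ D.MP0 := by
  let f : ℝ × ℝ × (V →L[ℝ] V) → (V →L[ℝ] V) := fun p => D.leviElt p.1 p.2.1 p.2.2
  let S : Set (ℝ × ℝ × (V →L[ℝ] V)) := Set.univ ×ˢ (Set.Ioi (0 : ℝ)) ×ˢ D.SO1n0
  have hS : IsPreconnected S :=
    isPreconnected_univ.prod (isPreconnected_Ioi.prod isPreconnected_connectedComponentIn)
  have hf : ContinuousOn f S := by
    have hinv : ContinuousOn (fun p : ℝ × ℝ × (V →L[ℝ] V) => (p.2.1)⁻¹) S :=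
      (continuous_fst.comp continuous_snd).continuousOn.inv₀ fun p hp => ne_of_gt hp.2.1
    have htor : ContinuousOn (fun p : ℝ × ℝ × (V →L[ℝ] V) => D.torus p.2.1) S := by
      simp only [torus, map_add, map_smul]
      fun_prop
    simp only [f, leviElt, unip]
    fun_prop
  have h1 : f (0, 1, 1) = 1 := by
    ext x
    simp [f, leviElt, unip_apply, torus_apply]
  have := (hS.image f hf).subset_connectedComponentIn (x := 1) (F := D.MP)
    ⟨(0, 1, 1), ⟨trivial, zero_lt_one' ℝ, D.one_mem_SO1n0⟩, h1⟩
    (by rintro _ ⟨p, hp, rfl⟩; exact leviElt_mem_MP hp.2.1 (SO1n0_subset hp.2.2))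
  exact this ⟨(s, t, u), ⟨trivial, ht, hu⟩, rfl⟩

theorem detU_leviElt (hu : u ∈ D.SO1n) : D.detU (D.leviElt s t u) = t := by
  rw [detU, leviElt_b_zero hu, leviElt_b_one hu]
  simp [pair_add_right, pair_smul_right, pair_b'_b]

/-- Needed because `beta` uses `Ring.inverse`, which is 0 away from units. -/
theorem isUnit_of_mem_SO {g : V →L[ℝ] V} (hg : g ∈ D.SO) : IsUnit g := by
  have h : IsUnit (LinearMap.det (g : V →ₗ[ℝ] V)) := by rw [hg.2]; exact isUnit_one
  let e := (LinearEquiv.ofIsUnitDet (f := (g : V →ₗ[ℝ] V)) (v := Module.finBasis ℝ V)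
    (v' := Module.finBasis ℝ V) (by rwa [LinearMap.det_toMatrix])).toContinuousLinearEquiv
  exact ⟨ContinuousLinearEquiv.unitsEquiv ℝ V |>.symm e, by ext x; rfl⟩

/-- As r is an isometry, r⁻¹ can be moved to the other side of the pairing, so only the images of
b₁, b₂, y₀, y₁ under r enter. -/
theorem beta_leviElt {T : V} (hT : D.MemV1n T) (ht : 0 < t) (hu : u ∈ D.SO1n) :
    D.beta D.y₀ T (D.leviElt s t u) =
      -(2 * t * s : ℝ) + ((2 - t * D.pair T (u D.y₁) : ℝ) : ℂ) * Complex.I := by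
  have hg : D.leviElt s t u ∈ D.SO := leviElt_mem_SO ht hu
  have hy : D.pair D.y₀ (u D.y₁) = 0 := by
    rw [pair_comm]; exact (memV1n_map_y₁ hu).2
  have h2 : (√2 : ℂ) * (√2 : ℂ) = 2 := by
    rw [← Complex.ofReal_mul, Real.mul_self_sqrt (by norm_num)]; norm_num
  have h3 : (√2 : ℂ) ≠ 0 := by
    intro h; rw [h] at h2; norm_num at h2
  simp only [beta, pair_inverse hg (isUnit_of_mem_SO hg), v₁, v₂, map_smul, pair_smul_right,
    leviElt_y₀ hu, leviElt_y₁ hu, leviElt_b_zero hu, leviElt_b_one hu, pair_add_right, pair_b'_b,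
    pair_y₀_y₀, hy, hT.2]
  simp
  field_simp
  linear_combination (Complex.I * ↑t * ↑(D.pair T (u D.y₁)) + 2 * ↑t * ↑s) * Complex.I_sq

end

end SplitSpace

/-! ### Rescaling and assembly of the Whittaker integral. -/

theorem besselPhase_integral_comp_mul (v : ℤ) {a t : ℝ} (ha : 0 < a) (ht : 0 < t) :
    Integrable (fun s : ℝ => besselPhase v (-(2 * t * s : ℝ) + (a : ℂ) * Complex.I)) ∧
      ∫ s : ℝ, besselPhase v (-(2 * t * s : ℝ) + (a : ℂ) * Complex.I) =
        (((2 * t)⁻¹ * (Real.pi * Real.exp (-a)) : ℝ) : ℂ) * Complex.I ^ v := by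
  obtain ⟨h1, h2⟩ := besselPhase_integral v ha
  refine ⟨h1.comp_mul_left' (R := 2 * t) (by positivity), ?_⟩
  rw [Measure.integral_comp_mul_left
    (fun x : ℝ => besselPhase v (-(x : ℂ) + (a : ℂ) * Complex.I)) (2 * t), h2,
    abs_of_pos (by positivity), Complex.real_smul, ← mul_assoc]
  push_cast
  ring

namespace SplitSpace

variable {V : Type*} [NormedAddCommGroup V] [NormedSpace ℝ V] (D : SplitSpace V)

theorem whittakerLevi_eq (ℓ : ℕ) (T₁ T₂ : V) (r : V →L[ℝ] V) :
    D.whittakerLevi ℓ T₁ T₂ r = ∑ v ∈ Finset.Icc (-(ℓ : ℤ)) (ℓ : ℤ),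
      besselPhase v (D.beta T₁ T₂ r) • ((((D.detU r) ^ ℓ * |D.detU r| : ℝ) : ℂ) •
        (((ℓ + v).toNat.factorial : ℂ) * ((ℓ - v).toNat.factorial : ℂ))⁻¹ • xy ℓ v) := by
  rw [whittakerLevi, Finset.smul_sum]
  refine Finset.sum_congr rfl fun v _ => ?_
  rw [smul_smul, smul_smul, smul_smul, besselPhase]
  congr 1
  ring

variable [FiniteDimensional ℝ V]

variable {D} in
theorem whittaker_integral {ℓ : ℕ} {T : V} (hT : D.MemV1n T) (hpos : D.PosDef T)
    {W : (V →L[ℝ] V) → VV ℓ} (hW : ∀ r ∈ D.MP0, W r = D.whittakerLevi ℓ D.y₀ T r)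
    {t : ℝ} (ht : 0 < t) {u : V →L[ℝ] V} (hu : u ∈ D.SO1n0) :
    Integrable (fun s : ℝ => W (D.leviElt s t u)) ∧
      ∫ s : ℝ, W (D.leviElt s t u) =
        ((Real.pi * t ^ ℓ * Real.exp (-(2 - t * D.pair T (u D.y₁))) / 2 : ℝ) : ℂ) •
          ∑ v ∈ Finset.Icc (-(ℓ : ℤ)) (ℓ : ℤ), (Complex.I ^ v /
            (((ℓ - v).toNat.factorial : ℂ) * ((ℓ + v).toNat.factorial : ℂ))) • xy ℓ v := by
  have ha : 0 < 2 - t * D.pair T (u D.y₁) := by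
    nlinarith [mul_pos ht (neg_pos.2 (pair_map_y₁_neg hT hpos hu))]
  have hf : ∀ s : ℝ, W (D.leviElt s t u) = ∑ v ∈ Finset.Icc (-(ℓ : ℤ)) (ℓ : ℤ),
      besselPhase v (-(2 * t * s : ℝ) + ((2 - t * D.pair T (u D.y₁) : ℝ) : ℂ) * Complex.I) •
        (((t ^ ℓ * t : ℝ) : ℂ) •
          (((ℓ + v).toNat.factorial : ℂ) * ((ℓ - v).toNat.factorial : ℂ))⁻¹ • xy ℓ v) := by
    intro s
    rw [hW _ (leviElt_mem_MP0 ht hu), whittakerLevi_eq, detU_leviElt (SO1n0_subset hu),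
      beta_leviElt hT ht (SO1n0_subset hu), abs_of_pos ht]
  simp only [hf]
  have hint := fun v (_ : v ∈ Finset.Icc (-(ℓ : ℤ)) (ℓ : ℤ)) =>
    ((besselPhase_integral_comp_mul v ha ht).1.smul_const (((t ^ ℓ * t : ℝ) : ℂ) •
      (((ℓ + v).toNat.factorial : ℂ) * ((ℓ - v).toNat.factorial : ℂ))⁻¹ • xy ℓ v))
  refine ⟨integrable_finsetSum _ hint, ?_⟩
  rw [integral_finsetSum _ hint, Finset.smul_sum]
  refine Finset.sum_congr rfl fun v _ => ?_
  rw [integral_smul_const, (besselPhase_integral_comp_mul v ha ht).2, smul_smul, smul_smul,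
    smul_smul]
  -- The Jacobian (2t)⁻¹ meets the factor |det m| = t, which leaves t^ℓ and the constant 1/2.
  congr 1
  have ht' : (t : ℂ) ≠ 0 := by exact_mod_cast ht.ne'
  generalize Real.exp (-(2 - t * D.pair T (u D.y₁))) = e
  push_cast
  rw [div_eq_mul_inv (Complex.I ^ v), mul_comm ((ℓ - v).toNat.factorial : ℂ)]
  field_simp

end SplitSpace

end QuaternionicWhittaker

theorem mainTheorem7 {V : Type*} [NormedAddCommGroup V] [NormedSpace ℝ V] [FiniteDimensional ℝ V]
    (D : QuaternionicWhittaker.SplitSpace V) (ℓ : ℕ) (hℓ : 1 ≤ ℓ) :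
    (∀ T : V, D.MemV1n T → D.PosDef T → D.PosSemidefPair D.y₀ T →
      ∀ W : (V →L[ℝ] V) → QuaternionicWhittaker.VV ℓ, D.IsWhittaker ℓ D.y₀ T W →
      ∀ t : ℝ, 0 < t → ∀ u ∈ D.SO1n0,
        Integrable (fun s : ℝ =>
          W (NormedSpace.exp (s • D.wedge (D.b 0) (D.b' 1)) * (D.torus t * u))) ∧
        ∫ s : ℝ, W (NormedSpace.exp (s • D.wedge (D.b 0) (D.b' 1)) * (D.torus t * u)) =
          ((Real.pi * t ^ ℓ * Real.exp (-(2 - t * D.pair T (u D.y₁))) / 2 : ℝ) : ℂ) •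
            ∑ v ∈ Finset.Icc (-(ℓ : ℤ)) (ℓ : ℤ),
              (Complex.I ^ v /
                (((ℓ - v).toNat.factorial : ℂ) * ((ℓ + v).toNat.factorial : ℂ))) •
                QuaternionicWhittaker.xy ℓ v) ∧
    ∀ v : ℤ, -(ℓ : ℤ) ≤ v → v ≤ ℓ → ∀ X : ℝ, 0 < X →
      QuaternionicWhittaker.besselSum v X =
        ((Real.pi / 2 * Real.exp (-X) : ℝ) : ℂ) * Complex.I ^ v := by
  refine ⟨fun T hT hpos _ W hW t ht u hu => ?_, fun v _ _ X hX =>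
    QuaternionicWhittaker.besselSum_eq v hX⟩
  simp only [D.exp_smul_wedge]
  exact QuaternionicWhittaker.SplitSpace.whittaker_integral hT hpos hW.normalized ht hu
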